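/- An instance $\psi$ of 3-Partitioned-3-SAT is a finite set of clauses, each a disjunction of at most three literals, over a set of $N = 3n$ variables that is partitioned into three disjoint sets $X^\alpha, X^\beta, X^\gamma$ of size $n$ each, such that no clause contains two distinct variables from the same part; the question is whether $\psi$ is satisfiable. An instance $(G,k)$ of Geodetic Set is a finite simple graph $G$ together with a positive integer $k$; the question is whether there is a set $S \subseteq V(G)$ with $|S| \le k$ such that every vertex of $G$ lies on a shortest path between two (not necessarily distinct) vertices of $S$. Let $\mathrm{vc}(G)$ be the minimum size of a vertex cover of $G$. **Theorem.** There is an algorithm that, given an instance $\psi$ of 3-Partitioned-3-SAT, constructs an instance $(G,k)$ of Geodetic Set such that $\psi$ is satisfiable if and only if $(G,k)$ is a Yes-instance. Moreover, if $N = 3n \ge 1$ is the number of variables of $\psi$, then the algorithm runs in time $2^{O(\sqrt N)}$, and $k = 10\lceil \sqrt n\,\rceil$, $\mathrm{vc}(G) + k = O(\sqrt N)$ and $|V(G)| = 2^{O(\sqrt N)}$, with absolute constants in the $O$-terms. (The algorithm is a deterministic random access machine with addition, subtraction and indirect addressing at unit cost; it reads a list of the clauses of $\psi$, and outputs $k$,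 $|V(G)|$ and the adjacency matrix of $G$.) -/

import Mathlib

/-! ### The machine model: a random access machine with a step count

A structured form of the usual unit-cost RAM with addition and (truncated) subtraction as its only
arithmetic, direct registers, indirectly addressed memory and an append-only output tape. There is
no multiplication, so this model and Turing machines simulate each other with polynomial overhead. -/

namespace RAM

/-- Expressions: a literal, the content of a register, sum, truncated difference, and the content
of cell `e` of memory bank `a`. -/
inductive Exp : Type
  | lit (c : ℕ) : Exp
  | var (x : ℕ) : Exp
  | add (e₁ e₂ : Exp) : Exp
  | sub (e₁ e₂ : Exp) : Exp
  | get (a : ℕ) (e : Exp) : Exp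

/-- Programs. Each program is a finite term, hence mentions finitely many registers and banks. -/
inductive Com : Type
  | skip : Com
  | assign (x : ℕ) (e : Exp) : Com
  | store (a : ℕ) (i e : Exp) : Com
  | print (e : Exp) : Com
  | seq (P Q : Com) : Com
  | ite (e : Exp) (P Q : Com) : Com
  | loop (e : Exp) (P : Com) : Com

/-- Machine states: registers, memory banks, and the output word printed so far. -/
structure Store : Type where
  reg : ℕ → ℕ
  mem : ℕ → ℕ → ℕ
  out : List ℕ

/-- The value of an expression. -/
def Exp.eval (σ : Store) : Exp → ℕ
  | .lit c => c
  | .var x => σ.reg x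
  | .add e₁ e₂ => e₁.eval σ + e₂.eval σ
  | .sub e₁ e₂ => e₁.eval σ - e₂.eval σ
  | .get a e => σ.mem a (e.eval σ)

/-- The number of elementary operations needed to evaluate an expression. -/
def Exp.cost : Exp → ℕ
  | .lit _ => 1
  | .var _ => 1
  | .add e₁ e₂ => e₁.cost + e₂.cost + 1
  | .sub e₁ e₂ => e₁.cost + e₂.cost + 1
  | .get _ e => e.cost + 1

/-- `Exec P σ t τ`: the program `P`, started in state `σ`, halts after exactly `t` steps in
state `τ`. The rules are deterministic. A test succeeds when its value is nonzero. -/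
inductive Exec : Com → Store → ℕ → Store → Prop
  | skip (σ : Store) : Exec .skip σ 1 σ
  | assign (x : ℕ) (e : Exp) (σ : Store) :
      Exec (.assign x e) σ (e.cost + 1) { σ with reg := Function.update σ.reg x (e.eval σ) }
  | store (a : ℕ) (i e : Exp) (σ : Store) :
      Exec (.store a i e) σ (i.cost + e.cost + 1)
        { σ with mem := Function.update σ.mem a
                          (Function.update (σ.mem a) (i.eval σ) (e.eval σ)) }
  | print (e : Exp) (σ : Store) :
      Exec (.print e) σ (e.cost + 1) { σ with out := σ.out ++ [e.eval σ] }
  | seq {P Q : Com} {σ τ ρ : Store} {s t : ℕ} :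
      Exec P σ s τ → Exec Q τ t ρ → Exec (.seq P Q) σ (s + t) ρ
  | ite_true {e : Exp} {P Q : Com} {σ τ : Store} {t : ℕ} :
      e.eval σ ≠ 0 → Exec P σ t τ → Exec (.ite e P Q) σ (e.cost + 1 + t) τ
  | ite_false {e : Exp} {P Q : Com} {σ τ : Store} {t : ℕ} :
      e.eval σ = 0 → Exec Q σ t τ → Exec (.ite e P Q) σ (e.cost + 1 + t) τ
  | loop_true {e : Exp} {P : Com} {σ τ ρ : Store} {s t : ℕ} :
      e.eval σ ≠ 0 → Exec P σ s τ → Exec (.loop e P) τ t ρ →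
      Exec (.loop e P) σ (e.cost + 1 + s + t) ρ
  | loop_false {e : Exp} {P : Com} {σ : Store} :
      e.eval σ = 0 → Exec (.loop e P) σ (e.cost + 1) σ

/-- The initial state on an input word `w`: its length is in register `0`, its letters are in the
first cells of bank `0`, everything else is zero, and nothing has been printed. -/
def initial (w : List ℕ) : Store where
  reg := Function.update (fun _ => 0) 0 w.length
  mem := Function.update (fun _ _ => 0) 0 (fun i => w.getD i 0)
  out := []

/-- On the input word `w`, the program `P` halts after exactly `t` steps with output `v`. -/
def RunsTo (P : Com) (w : List ℕ) (t : ℕ) (v : List ℕ) : Prop :=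
  ∃ σ : Store, Exec P (initial w) t σ ∧ σ.out = v

end RAM

/-! ### 3-Partitioned-3-SAT -/

/-- A literal over the variables `x^δ_i`, where `δ : Fin 3` names one of the three parts, each
consisting of `n` variables. `sign = true` is the positive literal. -/
structure PartLiteral (n : ℕ) : Type where
  part : Fin 3
  idx : Fin n
  sign : Bool

/-- An instance of 3-Partitioned-3-SAT: a set of clauses (a duplicate-free list), each a
disjunction of at most three literals, over three disjoint sets of `n` variables each, such that
no clause contains two distinct variables of the same part. -/
structure Partitioned3SAT : Type where
  n : ℕ
  clauses : List (List (PartLiteral n))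
  nodup : clauses.Nodup
  length_le : ∀ C ∈ clauses, C.length ≤ 3
  partitioned : ∀ C ∈ clauses, ∀ l ∈ C, ∀ l' ∈ C, l.part = l'.part → l.idx = l'.idx

namespace Partitioned3SAT

/-- The number `N` of variables. -/
def numVars (ψ : Partitioned3SAT) : ℕ := 3 * ψ.n

/-- Some truth assignment makes at least one literal of every clause true. -/
def Satisfiable (ψ : Partitioned3SAT) : Prop :=
  ∃ τ : Fin 3 → Fin ψ.n → Bool, ∀ C ∈ ψ.clauses, ∃ l ∈ C, τ l.part l.idx = l.sign

/-- The input word: `n`, the number of clauses, and then clause by clause its number of literals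
followed by its literals, a literal being given by its part, its index in the part and its sign. -/
def encode (ψ : Partitioned3SAT) : List ℕ :=
  ψ.n :: ψ.clauses.length ::
    ψ.clauses.flatMap fun C =>
      C.length :: C.flatMap fun l => [(l.part : ℕ), (l.idx : ℕ), if l.sign then 1 else 0]

end Partitioned3SAT

/-! ### Geodetic Set -/

/-- `u` lies on a shortest path from `s` to `t`. -/
def SimpleGraph.OnShortestPath {V : Type*} (G : SimpleGraph V) (s t u : V) : Prop :=
  ∃ p : G.Walk s t, p.IsPath ∧ p.length = G.dist s t ∧ u ∈ p.support

/-- Every vertex lies on a shortest path between two vertices of `S`. -/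
def SimpleGraph.IsGeodeticSet {V : Type*} (G : SimpleGraph V) (S : Set V) : Prop :=
  ∀ u : V, ∃ s₁ ∈ S, ∃ s₂ ∈ S, G.OnShortestPath s₁ s₂ u

/-- An instance `(G, k)` of Geodetic Set: a finite simple graph and a positive integer. -/
structure GeodeticSetInstance : Type where
  order : ℕ
  graph : SimpleGraph (Fin order)
  k : ℕ
  k_pos : 0 < k

namespace GeodeticSetInstance

/-- `(G, k)` is a Yes-instance: `G` has a geodetic set of at most `k` vertices. -/
def IsYes (I : GeodeticSetInstance) : Prop :=
  ∃ S : Finset (Fin I.order), S.card ≤ I.k ∧ I.graph.IsGeodeticSet (S : Set (Fin I.order))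

/-- The vertex cover number of the graph. -/
noncomputable def vc (I : GeodeticSetInstance) : ℕ := I.graph.vertexCoverNum.toNat

open Classical in
/-- The output word: `k`, the number of vertices, and the adjacency matrix row by row. -/
noncomputable def encode (I : GeodeticSetInstance) : List ℕ :=
  I.k :: I.order ::
    (List.finRange I.order).flatMap fun i =>
      (List.finRange I.order).map fun j => if I.graph.Adj i j then 1 else 0

end GeodeticSetInstance

/-!
Cut each of the three parts of the variables into `s = ⌈√n⌉` blocks of `s` variables. A truth
assignment is then a choice of one of `2 ^ s` assignments for each of `3 * s` blocks. In the gadget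
graph the leaves (one at the hub `y`, `4 * s - 1` at the hub `z`, one at every block) lie in every
geodetic set, and the guard of a block lies on a shortest path only if the set contains one more
vertex at that block. With `1 + (4 * s - 1) + 2 * (3 * s) = 10 * s` vertices allowed, a geodetic set
is therefore a choice of one assignment for every block, the vertex of a clause being on a shortest
path between the chosen vertex and the leaf of a block precisely if that choice satisfies the
clause. Since a clause has at most one variable of each part, a block satisfies it through at most
one value, and all edges have an end among the `O(s)` vertices that are neither assignments nor
clauses.
-/

local infix:62 " ::= " => RAM.Com.assign

local infixr:60 " ;; " => RAM.Com.seq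

/-! ### Running times and total correctness -/

namespace RAM

/-- A bound on the running time, as a polynomial in a bound on the number of rounds of every
loop. -/
noncomputable def Com.time : Com → Polynomial ℕ
  | .skip => 1
  | .assign _ e => .C (e.cost + 1)
  | .store _ i e => .C (i.cost + e.cost + 1)
  | .print e => .C (e.cost + 1)
  | .seq P Q => P.time + Q.time
  | .ite e P Q => .C (e.cost + 1) + P.time + Q.time
  | .loop e P => .X * (.C (e.cost + 1) + P.time) + .C (e.cost + 1)

/-- Partial knowledge of a state: the contents of the first registers, the memory, and the output.
Since the later registers are free, a program can use them as local variables. -/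
structure View : Type where
  regs : List ℕ
  mem : ℕ → ℕ → ℕ
  out : List ℕ

/-- The state `σ` is as described by `v`. -/
structure View.Holds (v : View) (σ : Store) : Prop where
  reg (x : ℕ) (hx : x < v.regs.length) : σ.reg x = v.regs[x]
  mem : σ.mem = v.mem
  out : σ.out = v.out

/-- The view with the content of one more register. -/
def View.push (v : View) (a : ℕ) : View := { v with regs := v.regs ++ [a] }

/-- The view after a change of the content of a register. -/
def View.set (v : View) (x a : ℕ) : View := { v with regs := v.regs.set x a }

/-- The expression `e` has the value `a` in all states described by `v`. -/
def Evals (v : View) (e : Exp) (a : ℕ) : Prop := ∀ σ, v.Holds σ → e.eval σ = a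

/-- Started in a state described by `v`, the program `P` halts in a state described by `v'`, within
its time bound for loops of at most `M` rounds. -/
def Runs (M : ℕ) (P : Com) (v v' : View) : Prop :=
  ∀ σ, v.Holds σ → ∃ t τ, Exec P σ t τ ∧ t ≤ P.time.eval M ∧ v'.Holds τ

instance : Add Exp := ⟨.add⟩

instance : Sub Exp := ⟨.sub⟩

instance (c : ℕ) : OfNat Exp c := ⟨.lit c⟩

/-- A constant multiple, as a repeated sum: the machine has no multiplication. -/
def Exp.smul : ℕ → Exp → Exp
  | 0, _ => 0
  | k + 1, e => smul k e + e

instance : SMul ℕ Exp := ⟨Exp.smul⟩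

section Exp

variable (e e₁ e₂ : Exp) (σ : Store)

@[simp] theorem Exp.eval_lit (c : ℕ) : (lit c).eval σ = c := rfl

@[simp] theorem Exp.eval_ofNat (c : ℕ) : (ofNat(c) : Exp).eval σ = c := rfl

@[simp] theorem Exp.eval_var (x : ℕ) : (var x).eval σ = σ.reg x := rfl

@[simp] theorem Exp.eval_add : (e₁ + e₂).eval σ = e₁.eval σ + e₂.eval σ := rfl

@[simp] theorem Exp.eval_sub : (e₁ - e₂).eval σ = e₁.eval σ - e₂.eval σ := rfl

@[simp] theorem Exp.eval_get (a : ℕ) : (get a e).eval σ = σ.mem a (e.eval σ) := rfl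

@[simp] theorem Exp.eval_smul (k : ℕ) : (k • e).eval σ = k * e.eval σ := by
  induction k with
  | zero => exact (zero_mul _).symm
  | succ k ih => rw [add_one_mul, ← ih]; rfl

end Exp

section Rules

variable {M : ℕ} {P Q : Com} {v v' v'' : View} {e e₁ e₂ : Exp} {a b n x : ℕ}

@[simp] theorem View.length_push : (v.push a).regs.length = v.regs.length + 1 :=
  List.length_append

theorem View.Holds.of_push {σ : Store} (h : (v.push a).Holds σ) : v.Holds σ where
  reg x hx := by
    rw [h.reg x (by rw [length_push]; omega)]
    exact List.getElem_append_left hx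
  mem := h.mem
  out := h.out

theorem Evals.push (h : Evals v e a) : Evals (v.push b) e a := fun σ hσ => h σ hσ.of_push

theorem Evals.add (h₁ : Evals v e₁ a) (h₂ : Evals v e₂ b) : Evals v (e₁ + e₂) (a + b) :=
  fun σ hσ => congrArg₂ _ (h₁ σ hσ) (h₂ σ hσ)

theorem Evals.sub (h₁ : Evals v e₁ a) (h₂ : Evals v e₂ b) : Evals v (e₁ - e₂) (a - b) :=
  fun σ hσ => congrArg₂ _ (h₁ σ hσ) (h₂ σ hσ)

theorem Evals.smul (k : ℕ) (h : Evals v e a) : Evals v (k • e) (k * a) := fun σ hσ => by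
  rw [Exp.eval_smul, h σ hσ]

theorem evals_ofNat (v : View) (c : ℕ) : Evals v ofNat(c) c := fun _ _ => rfl

theorem evals_var (hx : v.regs[x]? = some a) : Evals v (.var x) a := fun _ hσ =>
  let ⟨hx, ha⟩ := List.getElem?_eq_some_iff.1 hx
  (hσ.reg x hx).trans ha

theorem evals_var_push (hx : x = v.regs.length) : Evals (v.push a) (.var x) a :=
  evals_var (hx ▸ List.getElem?_concat_length)

theorem evals_get (h : Evals v e a) : Evals v (.get b e) (v.mem b a) := fun σ hσ => by
  rw [Exp.eval_get, h σ hσ, hσ.mem]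

theorem Runs.skip : Runs M .skip v v := fun σ h => ⟨1, σ, .skip σ, by simp [Com.time], h⟩

theorem Runs.assign (h : Evals v e a) : Runs M (x ::= e) v (v.set x a) := by
  refine fun σ hσ => ⟨_, _, .assign x e σ, by simp [Com.time], fun y hy => ?_, hσ.mem, hσ.out⟩
  simp only [View.set, List.length_set] at hy
  simp only [View.set, List.getElem_set, Function.update_apply, h σ hσ, hσ.reg y hy, eq_comm]

theorem Runs.assign_push (h : Evals v e a) (hx : x = v.regs.length) :
    Runs M (x ::= e) v (v.push a) := by
  refine fun σ hσ => ⟨_, _, .assign x e σ, by simp [Com.time], fun y hy => ?_, hσ.mem, hσ.out⟩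
  rw [View.length_push] at hy
  rcases Nat.lt_succ_iff_lt_or_eq.1 hy with hy | rfl
  · simp [View.push, List.getElem_append_left hy, (hx ▸ hy).ne, hσ.reg y hy]
  · simp [View.push, hx, h σ hσ]

theorem Runs.store {i : Exp} (hi : Evals v i b) (he : Evals v e a) :
    Runs M (.store x i e) v
      { v with mem := Function.update v.mem x (Function.update (v.mem x) b a) } := by
  refine fun σ hσ => ⟨_, _, .store x i e σ, by simp [Com.time], hσ.reg, ?_, hσ.out⟩
  rw [hi σ hσ, he σ hσ, hσ.mem]

theorem Runs.print (he : Evals v e a) : Runs M (.print e) v { v with out := v.out ++ [a] } := by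
  refine fun σ hσ => ⟨_, _, .print e σ, by simp [Com.time], hσ.reg, hσ.mem, ?_⟩
  rw [he σ hσ, hσ.out]

theorem Runs.seq (hP : Runs M P v v') (hQ : Runs M Q v' v'') : Runs M (P ;; Q) v v'' := by
  intro σ hσ
  obtain ⟨s, τ, hP, hs, hτ⟩ := hP σ hσ
  obtain ⟨t, ρ, hQ, ht, hρ⟩ := hQ τ hτ
  refine ⟨_, _, .seq hP hQ, ?_, hρ⟩
  rw [Com.time, Polynomial.eval_add]
  exact add_le_add hs ht

theorem Runs.pop (h : Runs M P v (v'.push a)) : Runs M P v v' := fun σ hσ =>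
  let ⟨t, τ, hP, ht, hτ⟩ := h σ hσ
  ⟨t, τ, hP, ht, hτ.of_push⟩

theorem Runs.ite (he : Evals v e a) (hP : a ≠ 0 → Runs M P v v') (hQ : a = 0 → Runs M Q v v') :
    Runs M (.ite e P Q) v v' := by
  intro σ hσ
  simp only [Com.time, Polynomial.eval_add, Polynomial.eval_C]
  by_cases ha : a = 0
  · obtain ⟨t, τ, h, ht, hτ⟩ := hQ ha σ hσ
    exact ⟨_, _, .ite_false ((he σ hσ).trans ha) h, by omega, hτ⟩
  · obtain ⟨t, τ, h, ht, hτ⟩ := hP ha σ hσ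
    exact ⟨_, _, .ite_true ((he σ hσ).trans_ne ha) h, by omega, hτ⟩

theorem Runs.loop {v : ℕ → View} (hn : n ≤ M) (hpos : ∀ i < n, ∃ a ≠ 0, Evals (v i) e a)
    (hzero : Evals (v n) e 0) (hP : ∀ i < n, Runs M P (v i) (v (i + 1))) :
    Runs M (.loop e P) (v 0) (v n) := by
  have rounds (k : ℕ) (hk : k ≤ n) (σ : Store) (hσ : (v (n - k)).Holds σ) :
      ∃ t τ, Exec (.loop e P) σ t τ ∧
        t ≤ k * (e.cost + 1 + P.time.eval M) + (e.cost + 1) ∧ (v n).Holds τ := by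
    induction k generalizing σ with
    | zero => exact ⟨_, σ, .loop_false (hzero σ hσ), by simp, hσ⟩
    | succ k ih =>
      obtain ⟨a, ha, he⟩ := hpos (n - (k + 1)) (by omega)
      obtain ⟨s, τ, h, hs, hτ⟩ := hP (n - (k + 1)) (by omega) σ hσ
      rw [show n - (k + 1) + 1 = n - k by omega] at hτ
      obtain ⟨t, ρ, h', ht, hρ⟩ := ih (by omega) τ hτ
      refine ⟨_, ρ, .loop_true ((he σ hσ).trans_ne ha) h h', ?_, hρ⟩
      rw [add_one_mul]
      omega
  intro σ hσ
  obtain ⟨t, τ, h, ht, hτ⟩ := rounds n le_rfl σ (by rwa [Nat.sub_self])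
  refine ⟨t, τ, h, ht.trans ?_, hτ⟩
  simp only [Com.time, Polynomial.eval_add, Polynomial.eval_mul, Polynomial.eval_X,
    Polynomial.eval_C]
  gcongr

/-! ### Arithmetic -/

/-- Repeats `P`, with the number of the round in register `x`. -/
def Com.count (x : ℕ) (e : Exp) (P : Com) : Com :=
  x ::= 0 ;; .loop (e - .var x) (P ;; x ::= .var x + 1)

theorem Runs.count {v : ℕ → View} (hx : ∀ i, x = (v i).regs.length) (hn : n ≤ M)
    (he : ∀ i, Evals (v i) e n) (hP : ∀ i < n, Runs M P ((v i).push i) ((v (i + 1)).push i)) :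
    Runs M (.count x e P) (v 0) (v n) := by
  have hsub (i : ℕ) : Evals ((v i).push i) (e - .var x) (n - i) :=
    (he i).push.sub (evals_var_push (hx i))
  refine .pop (a := n) (.seq (.assign_push (evals_ofNat _ 0) (hx 0)) ?_)
  refine .loop (v := fun i => (v i).push i) hn (fun i hi => ⟨n - i, by omega, hsub i⟩)
    (by simpa using hsub n) fun i hi => (hP i hi).seq ?_
  have hset : (((v (i + 1)).push i).set x (i + 1)) = (v (i + 1)).push (i + 1) := by
    simp [View.set, View.push, hx (i + 1)]
  exact hset ▸ .assign ((evals_var_push (hx (i + 1))).add (evals_ofNat _ 1))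

/-- Multiplication; the product is left in register `x`. -/
def Com.mul (x : ℕ) (e₁ e₂ : Exp) : Com := x ::= 0 ;; .count (x + 1) e₂ (x ::= .var x + e₁)

theorem Runs.mul (h₁ : Evals v e₁ a) (h₂ : Evals v e₂ b) (hb : b ≤ M) (hx : x = v.regs.length) :
    Runs M (.mul x e₁ e₂) v (v.push (a * b)) := by
  refine .seq (.assign_push (evals_ofNat _ 0) hx) ?_
  refine .count (v := fun i => v.push (a * i)) (by simp [hx]) hb (fun _ => h₂.push) fun i _ => ?_
  have hset : ((v.push (a * i)).push i).set x (a * i + a) = (v.push (a * (i + 1))).push i := by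
    simp [View.set, View.push, hx, mul_add_one]
  exact hset ▸ .assign ((evals_var_push hx).push.add h₁.push.push)

/-- Powers of two; the power is left in register `x`. -/
def Com.twoPow (x : ℕ) (e : Exp) : Com := x ::= 1 ;; .count (x + 1) e (x ::= .var x + .var x)

theorem Runs.twoPow (h : Evals v e a) (ha : a ≤ M) (hx : x = v.regs.length) :
    Runs M (.twoPow x e) v (v.push (2 ^ a)) := by
  refine .seq (.assign_push (evals_ofNat _ 1) hx) ?_
  refine .count (v := fun i => v.push (2 ^ i)) (by simp [hx]) ha (fun _ => h.push) fun i _ => ?_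
  have hset : ((v.push (2 ^ i)).push i).set x (2 ^ i + 2 ^ i) = (v.push (2 ^ (i + 1))).push i := by
    simp [View.set, View.push, hx, pow_succ, mul_two]
  exact hset ▸ .assign ((evals_var_push hx).push.add (evals_var_push hx).push)

/-- Division; the quotient is left in register `x`, and the remainder in register `x + 1`. -/
def Com.divMod (x : ℕ) (e₁ e₂ : Exp) : Com :=
  x ::= 0 ;; x + 1 ::= e₁ ;;
    .loop (.var (x + 1) + 1 - e₂) (x + 1 ::= .var (x + 1) - e₂ ;; x ::= .var x + 1)

theorem Runs.divMod (h₁ : Evals v e₁ a) (h₂ : Evals v e₂ b) (hb : 0 < b) (hM : a / b ≤ M)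
    (hx : x = v.regs.length) :
    Runs M (.divMod x e₁ e₂) v ((v.push (a / b)).push (a % b)) := by
  let w (i : ℕ) : View := (v.push i).push (a - b * i)
  have hrem (i : ℕ) : Evals (w i) (.var (x + 1)) (a - b * i) := evals_var_push (by simp [hx])
  have htest (i : ℕ) : Evals (w i) (.var (x + 1) + 1 - e₂) (a - b * i + 1 - b) :=
    ((hrem i).add (evals_ofNat _ 1)).sub h₂.push.push
  refine .seq (.assign_push (evals_ofNat _ 0) hx)
    (.seq (.assign_push h₁.push (by simp [hx])) ?_)
  rw [Nat.mod_eq_sub_mul_div]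
  refine .loop (v := w) hM (fun i hi => ⟨_, ?_, htest i⟩) ?_ fun i _ => ?_
  · have : b * (i + 1) ≤ a := (mul_comm _ _).trans_le ((Nat.le_div_iff_mul_le hb).1 hi)
    rw [mul_add_one] at this
    omega
  · have := Nat.mod_lt a hb
    rw [Nat.mod_eq_sub_mul_div] at this
    exact (show a - b * (a / b) + 1 - b = 0 by omega) ▸ htest (a / b)
  · refine .seq (.assign ((hrem i).sub h₂.push.push)) ?_
    have hset : (w i).set (x + 1) (a - b * i - b) = (v.push i).push (a - b * (i + 1)) := by
      simp [w, View.set, View.push, hx, mul_add_one, Nat.sub_sub]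
    have hset' : ((v.push i).push (a - b * (i + 1))).set x (i + 1) = w (i + 1) := by
      simp [w, View.set, View.push, hx]
    rw [hset, ← hset']
    exact .assign ((evals_var_push hx).push.add (evals_ofNat _ 1))

end Rules

end RAM

/-! ### Shortest paths through walks of given length -/

/-- There is a walk of length `k` from `u` to `v` in `G`. Distances are compared through such walks
instead of `SimpleGraph.dist`, whose value `0` on disconnected pairs would have to be excluded. -/
def HasWalk {V : Type*} (G : SimpleGraph V) (k : ℕ) (u v : V) : Prop :=
  ∃ p : G.Walk u v, p.length = k

section HasWalk

variable {V W : Type*} {G : SimpleGraph V} {H : SimpleGraph W} {u v w s t : V} {k l : ℕ}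

theorem HasWalk.refl (u : V) : HasWalk G 0 u u := ⟨.nil, rfl⟩

theorem HasWalk.cons (h : G.Adj u v) : HasWalk G k v w → HasWalk G (k + 1) u w :=
  fun ⟨p, hp⟩ => ⟨.cons h p, by rw [SimpleGraph.Walk.length_cons, hp]⟩

theorem HasWalk.of_adj (h : G.Adj u v) : HasWalk G 1 u v := .cons h (.refl v)

theorem HasWalk.symm : HasWalk G k u v → HasWalk G k v u :=
  fun ⟨p, hp⟩ => ⟨p.reverse, by rw [SimpleGraph.Walk.length_reverse, hp]⟩

theorem HasWalk.trans : HasWalk G k u v → HasWalk G l v w → HasWalk G (k + l) u w :=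
  fun ⟨p, hp⟩ ⟨q, hq⟩ => ⟨p.append q, by rw [SimpleGraph.Walk.length_append, hp, hq]⟩

theorem HasWalk.map (φ : G ≃g H) : HasWalk G k u v → HasWalk H k (φ u) (φ v) :=
  fun ⟨p, hp⟩ => ⟨p.map φ.toHom, (p.length_map _).trans hp⟩

theorem hasWalk_zero : HasWalk G 0 u v ↔ u = v :=
  ⟨fun ⟨p, hp⟩ => p.eq_of_length_eq_zero hp, fun h => h ▸ .refl u⟩

theorem hasWalk_succ : HasWalk G (k + 1) u v ↔ ∃ w, G.Adj u w ∧ HasWalk G k w v := by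
  refine ⟨?_, fun ⟨w, h, h'⟩ => .cons h h'⟩
  rintro ⟨_ | ⟨h, p⟩, hp⟩
  · simp at hp
  · exact ⟨_, h, p, by simpa using hp⟩

theorem HasWalk.le_add {f : V → ℕ} (hf : ∀ u v, G.Adj u v → f v ≤ f u + 1)
    (h : HasWalk G k u v) : f v ≤ f u + k := by
  induction k generalizing u with
  | zero => rw [hasWalk_zero.1 h, add_zero]
  | succ k ih =>
    obtain ⟨w, huw, hwv⟩ := hasWalk_succ.1 h
    have := ih hwv
    have := hf u w huw
    omega

theorem onShortestPath_iff_hasWalk : G.OnShortestPath s t u ↔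
    ∃ k l, HasWalk G k s u ∧ HasWalk G l u t ∧ ∀ j, HasWalk G j s t → k + l ≤ j := by
  constructor
  · rintro ⟨p, -, hp, hu⟩
    classical
    refine ⟨_, _, ⟨p.takeUntil u hu, rfl⟩, ⟨p.dropUntil u hu, rfl⟩, ?_⟩
    rintro _ ⟨q, rfl⟩
    rw [← SimpleGraph.Walk.length_append, p.take_spec hu, hp]
    exact SimpleGraph.dist_le q
  · rintro ⟨_, _, ⟨p, rfl⟩, ⟨q, rfl⟩, hmin⟩
    have hdist : (p.append q).length = G.dist s t := by
      refine le_antisymm ?_ (SimpleGraph.dist_le _)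
      obtain ⟨r, hr⟩ := (p.append q).reachable.exists_walk_length_eq_dist
      rw [SimpleGraph.Walk.length_append, ← hr]
      exact hmin _ ⟨r, rfl⟩
    exact ⟨p.append q, SimpleGraph.Walk.isPath_of_length_eq_dist _ hdist, hdist, by simp⟩

theorem onShortestPath_of_lipschitz {f : V → ℕ} (hf : ∀ u v, G.Adj u v → f v ≤ f u + 1)
    (hs : HasWalk G k s u) (ht : HasWalk G l u t) (hst : f s + (k + l) ≤ f t) :
    G.OnShortestPath s t u := by
  refine onShortestPath_iff_hasWalk.2 ⟨k, l, hs, ht, fun j hj => ?_⟩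
  have := hj.le_add hf
  omega

theorem onShortestPath_self (u : V) : G.OnShortestPath u u u :=
  onShortestPath_iff_hasWalk.2 ⟨0, 0, .refl u, .refl u, fun _ _ => Nat.zero_le _⟩

theorem onShortestPath_symm (h : G.OnShortestPath s t u) : G.OnShortestPath t s u := by
  obtain ⟨k, l, hs, ht, hmin⟩ := onShortestPath_iff_hasWalk.1 h
  refine onShortestPath_iff_hasWalk.2 ⟨l, k, ht.symm, hs.symm, fun j hj => ?_⟩
  rw [add_comm]
  exact hmin j hj.symm

theorem mem_of_isGeodeticSet_of_subsingleton_neighborSet {S : Set V} (hS : G.IsGeodeticSet S)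
    (hu : (G.neighborSet u).Subsingleton) : u ∈ S := by
  obtain ⟨s, hs, t, ht, hst⟩ := hS u
  obtain ⟨_ | k, _ | l, hk, hl, hmin⟩ := onShortestPath_iff_hasWalk.1 hst
  · rwa [← hasWalk_zero.1 hk]
  · rwa [← hasWalk_zero.1 hk]
  · rwa [hasWalk_zero.1 hl]
  · obtain ⟨v, hv, hk⟩ := hasWalk_succ.1 hk.symm
    obtain ⟨w, hw, hl⟩ := hasWalk_succ.1 hl
    obtain rfl := hu hv hw
    have := hmin _ (hk.symm.trans hl)
    omega

theorem onShortestPath_map (φ : G ≃g H) (h : G.OnShortestPath s t u) :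
    H.OnShortestPath (φ s) (φ t) (φ u) := by
  obtain ⟨k, l, hs, ht, hmin⟩ := onShortestPath_iff_hasWalk.1 h
  refine onShortestPath_iff_hasWalk.2 ⟨k, l, hs.map φ, ht.map φ, fun j hj => hmin j ?_⟩
  simpa using hj.map φ.symm

theorem exists_isGeodeticSet_of_iso (φ : G ≃g H)
    (h : ∃ S : Finset V, S.card ≤ k ∧ G.IsGeodeticSet (S : Set V)) :
    ∃ S : Finset W, S.card ≤ k ∧ H.IsGeodeticSet (S : Set W) := by
  obtain ⟨S, hcard, hS⟩ := h
  refine ⟨S.map φ.toEquiv.toEmbedding, by rwa [Finset.card_map], fun u => ?_⟩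
  obtain ⟨s, hs, t, ht, hst⟩ := hS (φ.symm u)
  refine ⟨φ s, by simpa using hs, φ t, by simpa using ht, ?_⟩
  simpa using onShortestPath_map φ hst

end HasWalk

theorem isSome_and_injOn_of_card_le {V X : Type*} [Fintype X] {S : Finset V} {f : V → Option X}
    (hf : ∀ x, ∃ u ∈ S, f u = some x) (hcard : S.card ≤ Fintype.card X) :
    (∀ u ∈ S, (f u).isSome) ∧ Set.InjOn f S := by
  classical
  have hsub : Finset.univ.map .some ⊆ S.image f := fun o ho => by
    obtain ⟨x, -, rfl⟩ := Finset.mem_map.1 ho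
    simpa using hf x
  have himage : Finset.univ.map .some = S.image f :=
    Finset.eq_of_subset_of_card_le hsub
      (Finset.card_image_le.trans (by rwa [Finset.card_map, Finset.card_univ]))
  constructor
  · intro u hu
    have : f u ∈ Finset.univ.map .some := himage ▸ Finset.mem_image_of_mem f hu
    obtain ⟨x, -, hx⟩ := Finset.mem_map.1 this
    exact hx ▸ rfl
  · refine Finset.card_image_iff.1 (le_antisymm Finset.card_image_le ?_)
    rwa [← himage, Finset.card_map, Finset.card_univ]

/-! ### The gadget graph -/

/-- The vertices of the graph of the reduction: `β` is the type of blocks of variables, `α` of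
truth assignments of a block, `τ` of values `x ↦ b` of single variables, `Γ` of clauses, and `π`
indexes the leaves at `z`. Besides the leaves, a solution has room for one vertex among
`assignment b f`, `link b` and `guard b` for every block `b`. -/
inductive GadgetVertex (β α τ Γ π : Type*) : Type _
  | y
  | z
  | yLeaf
  | zLeaf (i : π)
  | block (b : β)
  | detour (b : β)
  | blockLeaf (b : β)
  | link (b : β)
  | guard (b : β)
  | value (j : τ)
  | assignment (b : β) (f : α)
  | clause (C : Γ)

/-- The data of a satisfiability problem in which an assignment is chosen for every block:
`sat b f j` if the assignment `f` of the block `b` takes the value `j`, and `inBlock C b`,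
`inValue C j` if the clause `C` has a literal in the block `b`, or with the value `j`. -/
structure ChoicePattern (β α τ Γ : Type*) where
  sat : β → α → τ → Prop
  inBlock : Γ → β → Prop
  inValue : Γ → τ → Prop

namespace ChoicePattern

variable {β α τ Γ π : Type*} (D : ChoicePattern β α τ Γ)

/-- Assignments can be chosen for all blocks so that every clause contains a value that the
assignment of one of its blocks takes. -/
def Satisfiable : Prop :=
  ∃ f : β → α, ∀ C, ∃ b, D.inBlock C b ∧ ∃ j, D.inValue C j ∧ D.sat b (f b) j

/-- The edges of the gadget graph, each in one direction. -/
inductive Edge : GadgetVertex β α τ Γ π → GadgetVertex β α τ Γ π → Prop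
  | yLeaf : Edge .y .yLeaf
  | yBlock (b : β) : Edge .y (.block b)
  | yValue (j : τ) : Edge .y (.value j)
  | zLeaf (i : π) : Edge .z (.zLeaf i)
  | zAssignment (b : β) (f : α) : Edge .z (.assignment b f)
  | blockBlock (b b' : β) (h : b ≠ b') : Edge (.block b) (.block b')
  | blockDetour (b : β) : Edge (.block b) (.detour b)
  | blockLeaf (b : β) : Edge (.block b) (.blockLeaf b)
  | blockGuard (b : β) : Edge (.block b) (.guard b)
  | linkGuard (b : β) : Edge (.link b) (.guard b)
  | linkAssignment (b : β) (f : α) : Edge (.link b) (.assignment b f)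
  | assignmentDetour (b b' : β) (f : α) (h : b ≠ b') : Edge (.assignment b f) (.detour b')
  | assignmentValue (b : β) (f : α) (j : τ) (h : D.sat b f j) : Edge (.assignment b f) (.value j)
  | clauseBlock (C : Γ) (b : β) (h : D.inBlock C b) : Edge (.clause C) (.block b)
  | clauseValue (C : Γ) (j : τ) (h : D.inValue C j) : Edge (.clause C) (.value j)

variable (π) in
/-- The graph of the reduction. It is built so that `clause C` can only be on a shortest path from
`assignment b f` to `blockLeaf b`, and is on one if and only if `f` satisfies `C`. -/
def graph : SimpleGraph (GadgetVertex β α τ Γ π) where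
  Adj u v := D.Edge u v ∨ D.Edge v u
  symm := ⟨fun _ _ h => h.symm⟩
  loopless := ⟨by rintro u (h | h) <;> cases h <;> contradiction⟩

variable {D} {u v s t : GadgetVertex β α τ Γ π} {k l : ℕ}

theorem Edge.adj (h : D.Edge u v) : (D.graph π).Adj u v := .inl h

theorem Edge.adj_symm (h : D.Edge u v) : (D.graph π).Adj v u := .inr h

theorem lipschitz_of_edge {f : GadgetVertex β α τ Γ π → ℕ}
    (hf : ∀ u v, D.Edge u v → f v ≤ f u + 1 ∧ f u ≤ f v + 1) (u v : GadgetVertex β α τ Γ π)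
    (h : (D.graph π).Adj u v) : f v ≤ f u + 1 :=
  h.elim (fun h => (hf u v h).1) fun h => (hf v u h).2

/-! ### A satisfying choice gives a geodetic set -/

/-- A Lipschitz potential that bounds the distance from the leaves at `z` from below. -/
def zLevel : GadgetVertex β α τ Γ π → ℕ
  | .zLeaf _ => 0
  | .z => 1
  | .assignment _ _ => 2
  | .value _ | .detour _ | .link _ => 3
  | .y | .block _ | .guard _ | .clause _ => 4
  | .blockLeaf _ | .yLeaf => 5

theorem zLevel_le_succ (u v : GadgetVertex β α τ Γ π) :
    (D.graph π).Adj u v → zLevel v ≤ zLevel u + 1 :=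
  lipschitz_of_edge (by rintro u v h; cases h <;> simp [zLevel]) u v

open Classical in
/-- A Lipschitz potential that bounds the distance from `blockLeaf b₀` from below. -/
noncomputable def blockLevel (b₀ : β) : GadgetVertex β α τ Γ π → ℕ
  | .blockLeaf b => if b = b₀ then 0 else 2
  | .block b => if b = b₀ then 1 else 2
  | .detour b | .guard b => if b = b₀ then 2 else 3
  | .assignment b _ => if b = b₀ then 4 else 3
  | .y | .yLeaf | .clause _ => 2
  | .value _ | .link _ | .z | .zLeaf _ => 3

theorem blockLevel_le_succ (b₀ : β) (u v : GadgetVertex β α τ Γ π) :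
    (D.graph π).Adj u v → blockLevel b₀ v ≤ blockLevel b₀ u + 1 := by
  refine lipschitz_of_edge (fun u v h => ?_) u v
  cases h <;> simp only [blockLevel] <;> (try split_ifs) <;> simp_all

theorem hasWalk_zLeaf_assignment (i : π) (b : β) (f : α) :
    HasWalk (D.graph π) 2 (.zLeaf i) (.assignment b f) :=
  .cons (Edge.zLeaf i).adj_symm (.of_adj (Edge.zAssignment b f).adj)

theorem hasWalk_zLeaf_detour [Nontrivial β] [Nonempty α] (i : π) (b : β) :
    HasWalk (D.graph π) 3 (.zLeaf i) (.detour b) := by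
  obtain ⟨b', hb'⟩ := exists_ne b
  obtain ⟨f⟩ := ‹Nonempty α›
  exact (hasWalk_zLeaf_assignment i b' f).trans (.of_adj (Edge.assignmentDetour b' b f hb').adj)

theorem hasWalk_detour_blockLeaf (b : β) :
    HasWalk (D.graph π) 2 (.detour b) (.blockLeaf b) :=
  .cons (Edge.blockDetour b).adj_symm (.of_adj (Edge.blockLeaf b).adj)

theorem hasWalk_assignment_link (b : β) (f : α) :
    HasWalk (D.graph π) 1 (.assignment b f) (.link b) :=
  .of_adj (Edge.linkAssignment b f).adj_symm

theorem hasWalk_link_guard (b : β) : HasWalk (D.graph π) 1 (.link b) (.guard b) :=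
  .of_adj (Edge.linkGuard b).adj

theorem hasWalk_guard_block (b : β) : HasWalk (D.graph π) 1 (.guard b) (.block b) :=
  .of_adj (Edge.blockGuard b).adj_symm

theorem hasWalk_block_blockLeaf (b : β) : HasWalk (D.graph π) 1 (.block b) (.blockLeaf b) :=
  .of_adj (Edge.blockLeaf b).adj

theorem onShortestPath_zLeaf_yLeaf (i : π) (hk : HasWalk (D.graph π) k (.zLeaf i) u)
    (hl : HasWalk (D.graph π) l u .yLeaf) (hkl : k + l = 5) :
    (D.graph π).OnShortestPath (.zLeaf i) .yLeaf u :=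
  onShortestPath_of_lipschitz zLevel_le_succ hk hl (by simp [zLevel, hkl])

theorem onShortestPath_zLeaf_blockLeaf (i : π) (b : β) (hk : HasWalk (D.graph π) k (.zLeaf i) u)
    (hl : HasWalk (D.graph π) l u (.blockLeaf b)) (hkl : k + l = 5) :
    (D.graph π).OnShortestPath (.zLeaf i) (.blockLeaf b) u :=
  onShortestPath_of_lipschitz zLevel_le_succ hk hl (by simp [zLevel, hkl])

theorem onShortestPath_assignment_blockLeaf (b : β) (f : α)
    (hk : HasWalk (D.graph π) k (.assignment b f) u)
    (hl : HasWalk (D.graph π) l u (.blockLeaf b)) (hkl : k + l = 4) :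
    (D.graph π).OnShortestPath (.assignment b f) (.blockLeaf b) u :=
  onShortestPath_symm <| onShortestPath_of_lipschitz (blockLevel_le_succ b) hl.symm hk.symm
    (by simp [blockLevel, add_comm l, hkl])

theorem onShortestPath_zLeaf_yLeaf_of_sat (i : π) {b : β} {f : α} {j : τ} (h : D.sat b f j)
    (hu : u = .z ∨ u = .assignment b f ∨ u = .value j ∨ u = .y) :
    (D.graph π).OnShortestPath (.zLeaf i) .yLeaf u := by
  have hz : HasWalk (D.graph π) 1 (.zLeaf i) .z := .of_adj (Edge.zLeaf i).adj_symm
  have hza : HasWalk (D.graph π) 1 .z (.assignment b f) := .of_adj (Edge.zAssignment b f).adj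
  have hav : HasWalk (D.graph π) 1 (.assignment b f) (.value j) :=
    .of_adj (Edge.assignmentValue b f j h).adj
  have hvy : HasWalk (D.graph π) 1 (.value j) .y := .of_adj (Edge.yValue j).adj_symm
  have hy : HasWalk (D.graph π) 1 .y .yLeaf := .of_adj Edge.yLeaf.adj
  rcases hu with rfl | rfl | rfl | rfl
  · exact onShortestPath_zLeaf_yLeaf i hz (hza.trans (hav.trans (hvy.trans hy))) rfl
  · exact onShortestPath_zLeaf_yLeaf i (hz.trans hza) (hav.trans (hvy.trans hy)) rfl
  · exact onShortestPath_zLeaf_yLeaf i ((hz.trans hza).trans hav) (hvy.trans hy) rfl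
  · exact onShortestPath_zLeaf_yLeaf i (((hz.trans hza).trans hav).trans hvy) hy rfl

theorem onShortestPath_clause {b : β} {f : α} {j : τ} {C : Γ} (hb : D.inBlock C b)
    (hj : D.inValue C j) (h : D.sat b f j) :
    (D.graph π).OnShortestPath (.assignment b f) (.blockLeaf b) (.clause C) :=
  onShortestPath_assignment_blockLeaf b f
    (.cons (Edge.assignmentValue b f j h).adj (.of_adj (Edge.clauseValue C j hj).adj_symm))
    (.cons (Edge.clauseBlock C b hb).adj (hasWalk_block_blockLeaf b)) rfl

theorem isGeodeticSet_of_choice [Nonempty π] [Nontrivial β] [Nonempty α] (f : β → α)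
    {S : Set (GadgetVertex β α τ Γ π)}
    (hz : ∀ i, .zLeaf i ∈ S) (hy : .yLeaf ∈ S) (hb : ∀ b, .blockLeaf b ∈ S)
    (ha : ∀ b, .assignment b (f b) ∈ S)
    (hat : ∀ b f, ∃ j, D.sat b f j) (hta : ∀ j, ∃ b f, D.sat b f j)
    (hC : ∀ C, ∃ b, D.inBlock C b ∧ ∃ j, D.inValue C j ∧ D.sat b (f b) j) :
    (D.graph π).IsGeodeticSet S := by
  obtain ⟨i⟩ := ‹Nonempty π›
  obtain ⟨b₀⟩ := (inferInstance : Nonempty β)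
  obtain ⟨j₀, h₀⟩ := hat b₀ (f b₀)
  rintro (_ | _ | _ | i' | b | b | b | b | b | j | ⟨b, g⟩ | C)
  · exact ⟨_, hz i, _, hy, onShortestPath_zLeaf_yLeaf_of_sat i h₀ (by simp)⟩
  · exact ⟨_, hz i, _, hy, onShortestPath_zLeaf_yLeaf_of_sat i h₀ (by simp)⟩
  · exact ⟨_, hy, _, hy, onShortestPath_self _⟩
  · exact ⟨_, hz i', _, hz i', onShortestPath_self _⟩
  · exact ⟨_, hz i, _, hb b, onShortestPath_zLeaf_blockLeaf i b ((hasWalk_zLeaf_detour i b).trans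
      (.of_adj (Edge.blockDetour b).adj_symm)) (hasWalk_block_blockLeaf b) rfl⟩
  · exact ⟨_, hz i, _, hb b, onShortestPath_zLeaf_blockLeaf i b (hasWalk_zLeaf_detour i b)
      (hasWalk_detour_blockLeaf b) rfl⟩
  · exact ⟨_, hb b, _, hb b, onShortestPath_self _⟩
  · exact ⟨_, ha b, _, hb b, onShortestPath_assignment_blockLeaf b (f b)
      (hasWalk_assignment_link b (f b)) ((hasWalk_link_guard b).trans
        ((hasWalk_guard_block b).trans (hasWalk_block_blockLeaf b))) rfl⟩
  · exact ⟨_, ha b, _, hb b, onShortestPath_assignment_blockLeaf b (f b)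
      ((hasWalk_assignment_link b (f b)).trans (hasWalk_link_guard b))
      ((hasWalk_guard_block b).trans (hasWalk_block_blockLeaf b)) rfl⟩
  · obtain ⟨b, g, hj⟩ := hta j
    exact ⟨_, hz i, _, hy, onShortestPath_zLeaf_yLeaf_of_sat i hj (by simp)⟩
  · obtain ⟨j, hj⟩ := hat b g
    exact ⟨_, hz i, _, hy, onShortestPath_zLeaf_yLeaf_of_sat i hj (by simp)⟩
  · obtain ⟨b, hb', j, hj, h⟩ := hC C
    exact ⟨_, ha b, _, hb b, onShortestPath_clause hb' hj h⟩

/-! ### A geodetic set gives a satisfying choice -/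

/-- The place that a vertex takes in a solution of minimum size, which consists of the leaves and
one vertex `assignment b f`, `link b` or `guard b` for every block `b`. -/
def slot : GadgetVertex β α τ Γ π → Option (Option π ⊕ β ⊕ β)
  | .yLeaf => some (.inl none)
  | .zLeaf i => some (.inl (some i))
  | .blockLeaf b => some (.inr (.inl b))
  | .assignment b _ | .link b | .guard b => some (.inr (.inr b))
  | _ => none

theorem block_or_assignment_of_adj {b : β} {w : GadgetVertex β α τ Γ π}
    (hu : slot u ≠ some (.inr (.inr b))) (hw : slot w = some (.inr (.inr b)))
    (h : (D.graph π).Adj u w) :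
    u = .block b ∨ ∃ f, w = .assignment b f ∧
      (u = .z ∨ (∃ b' ≠ b, u = .detour b') ∨ ∃ j, u = .value j) := by
  rcases h with h | h <;> cases h <;> simp_all [slot]
  tauto

theorem hasWalk_block_of_adj_assignment [Nontrivial β] [Nonempty α] {b : β}
    (hu : u = .z ∨ (∃ b' ≠ b, u = .detour b') ∨ ∃ j, u = .value j) :
    ∃ j ≤ 3, HasWalk (D.graph π) j u (.block b) := by
  rcases hu with rfl | ⟨b', hb', rfl⟩ | ⟨j, rfl⟩
  · obtain ⟨b', hb'⟩ := exists_ne b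
    obtain ⟨f⟩ := ‹Nonempty α›
    exact ⟨3, le_rfl, .cons (Edge.zAssignment b' f).adj
      (.cons (Edge.assignmentDetour b' b f hb').adj (.of_adj (Edge.blockDetour b).adj_symm))⟩
  · exact ⟨2, by norm_num, .cons (Edge.blockDetour b').adj_symm
      (.of_adj (Edge.blockBlock b' b hb').adj)⟩
  · exact ⟨2, by norm_num, .cons (Edge.yValue j).adj_symm (.of_adj (Edge.yBlock b).adj)⟩

theorem two_le_of_hasWalk_assignment_guard {b : β} {f : α}
    (h : HasWalk (D.graph π) k (.assignment b f) (.guard b)) : 2 ≤ k := by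
  rcases k with _ | _ | k
  · cases hasWalk_zero.1 h
  · obtain ⟨w, hw, h⟩ := hasWalk_succ.1 h
    obtain rfl := hasWalk_zero.1 h
    rcases hw with hw | hw <;> cases hw
  · omega

theorem hasWalk_block_of_hasWalk_guard [Nontrivial β] [Nonempty α] {b : β}
    (hu : slot u ≠ some (.inr (.inr b))) (h : HasWalk (D.graph π) k u (.guard b)) :
    ∃ j ≤ k, HasWalk (D.graph π) j u (.block b) := by
  induction k generalizing u with
  | zero => cases hasWalk_zero.1 h; exact absurd rfl hu
  | succ k ih =>
    obtain ⟨w, huw, hw⟩ := hasWalk_succ.1 h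
    by_cases hloc : slot w = some (.inr (.inr b))
    · rcases block_or_assignment_of_adj hu hloc huw with rfl | ⟨f, rfl, hu⟩
      · exact ⟨0, Nat.zero_le _, .refl _⟩
      · have := two_le_of_hasWalk_assignment_guard hw
        obtain ⟨j, hj, hub⟩ := hasWalk_block_of_adj_assignment hu (D := D)
        exact ⟨j, by omega, hub⟩
    · obtain ⟨j, hj, hwb⟩ := ih hloc hw
      exact ⟨j + 1, by omega, .cons huw hwb⟩

theorem exists_mem_slot [Nontrivial β] [Nonempty α] {S : Set (GadgetVertex β α τ Γ π)}
    (hS : (D.graph π).IsGeodeticSet S) (b : β) : ∃ u ∈ S, slot u = some (.inr (.inr b)) := by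
  by_contra! hno
  obtain ⟨s, hs, t, ht, hst⟩ := hS (.guard b)
  obtain ⟨_ | k, _ | l, hk, hl, hmin⟩ := onShortestPath_iff_hasWalk.1 hst
  · exact hno s hs (hasWalk_zero.1 hk ▸ rfl)
  · exact hno s hs (hasWalk_zero.1 hk ▸ rfl)
  · exact hno t ht (hasWalk_zero.1 hl ▸ rfl)
  obtain ⟨i, hi, hsb⟩ := hasWalk_block_of_hasWalk_guard (hno s hs) hk
  obtain ⟨j, hj, htb⟩ := hasWalk_block_of_hasWalk_guard (hno t ht) hl.symm
  have neighbor (w : GadgetVertex β α τ Γ π) (h : (D.graph π).Adj (.guard b) w) :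
      w = .block b ∨ w = .link b := by
    rcases h with h | h <;> cases h <;> simp
  obtain ⟨w, hw, hsw⟩ := hasWalk_succ.1 hk.symm
  obtain ⟨w', hw', htw⟩ := hasWalk_succ.1 hl
  rcases neighbor w hw with rfl | rfl
  · have := hmin _ (hsw.symm.trans htb.symm)
    omega
  rcases neighbor w' hw' with rfl | rfl
  · have := hmin _ (hsb.trans htw)
    omega
  · have := hmin _ (hsw.symm.trans htw)
    omega

open Classical in
/-- A Lipschitz potential that bounds the distance from `clause C` from below. -/
noncomputable def clauseLevel (C : Γ) : GadgetVertex β α τ Γ π → ℕ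
  | .zLeaf _ => 4
  | .yLeaf | .link _ | .z => 3
  | .value _ | .block _ => 1
  | .detour _ | .y | .assignment _ _ | .guard _ | .blockLeaf _ => 2
  | .clause C' => if C' = C then 0 else 2

theorem clauseLevel_le {C : Γ} (h : HasWalk (D.graph π) k (.clause C) u) :
    clauseLevel C u ≤ k := by
  have hle := h.le_add (f := clauseLevel C) (lipschitz_of_edge fun u v h => by
    cases h <;> simp only [clauseLevel] <;> (try split_ifs) <;> simp_all)
  simpa [clauseLevel] using hle

/-- The vertices `s` and `t` are too close for a shortest path through `clause C`. -/
def Close (D : ChoicePattern β α τ Γ) (C : Γ) (s t : GadgetVertex β α τ Γ π) : Prop :=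
  ∃ j < clauseLevel C s + clauseLevel C t, HasWalk (D.graph π) j s t

theorem Close.symm {C : Γ} : D.Close C s t → D.Close C t s :=
  fun ⟨j, hj, h⟩ => ⟨j, by omega, h.symm⟩

theorem Close.not_onShortestPath {C : Γ} (h : D.Close C s t) :
    ¬ (D.graph π).OnShortestPath s t (.clause C) := by
  obtain ⟨j, hj, hst⟩ := h
  rw [onShortestPath_iff_hasWalk]
  rintro ⟨k, l, hk, hl, hmin⟩
  have := clauseLevel_le hk.symm
  have := clauseLevel_le hl
  have := hmin j hst
  omega

theorem Close.of_hub {C : Γ} {w : GadgetVertex β α τ Γ π} (hs : HasWalk (D.graph π) k s w)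
    (ht : HasWalk (D.graph π) l t w) (h : k + l < clauseLevel C s + clauseLevel C t) :
    D.Close C s t :=
  ⟨k + l, h, hs.trans ht.symm⟩

theorem exists_hasWalk_z [Nontrivial β] [Nonempty α] (hat : ∀ b f, ∃ j, D.sat b f j) (C : Γ)
    (hu : (slot u).isSome) : ∃ k < clauseLevel C u + 3, HasWalk (D.graph π) k u .z := by
  have assignment_z (b : β) (f : α) : HasWalk (D.graph π) 1 (.assignment b f) .z :=
    .of_adj (Edge.zAssignment b f).adj_symm
  obtain ⟨f⟩ := ‹Nonempty α›
  rcases u with _ | _ | _ | i | b | b | b | b | b | j | ⟨b, g⟩ | C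
  case yLeaf =>
    obtain ⟨b⟩ := (inferInstance : Nonempty β)
    obtain ⟨j, hj⟩ := hat b f
    exact ⟨4, by simp [clauseLevel], .cons Edge.yLeaf.adj_symm (.cons (Edge.yValue j).adj
      (.cons (Edge.assignmentValue b f j hj).adj_symm (assignment_z b f)))⟩
  case zLeaf => exact ⟨1, by simp [clauseLevel], .of_adj (Edge.zLeaf i).adj_symm⟩
  case blockLeaf =>
    obtain ⟨b', hb'⟩ := exists_ne b
    exact ⟨4, by simp [clauseLevel], (hasWalk_detour_blockLeaf b).symm.trans
      (.cons (Edge.assignmentDetour b' b f hb').adj_symm (assignment_z b' f))⟩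
  case link =>
    exact ⟨2, by simp [clauseLevel], .cons (Edge.linkAssignment b f).adj (assignment_z b f)⟩
  case guard =>
    exact ⟨3, by simp [clauseLevel], .cons (Edge.linkGuard b).adj_symm
      (.cons (Edge.linkAssignment b f).adj (assignment_z b f))⟩
  case assignment => exact ⟨1, by simp [clauseLevel], assignment_z b g⟩
  all_goals cases hu

theorem close_zLeaf [Nontrivial β] [Nonempty α] (hat : ∀ b f, ∃ j, D.sat b f j) (C : Γ) (i : π)
    (hu : (slot u).isSome) : D.Close C (.zLeaf i) u := by
  obtain ⟨k, hk, huz⟩ := exists_hasWalk_z hat C hu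
  refine .of_hub (.of_adj (Edge.zLeaf i).adj_symm) huz ?_
  rw [show clauseLevel C (.zLeaf i : GadgetVertex β α τ Γ π) = 4 from rfl]
  omega

theorem exists_hasWalk_y (hat : ∀ b f, ∃ j, D.sat b f j) (C : Γ) (hu : (slot u).isSome)
    (hz : ∀ i, u ≠ .zLeaf i) : ∃ k ≤ clauseLevel C u, HasWalk (D.graph π) k u .y := by
  have block_y (b : β) : HasWalk (D.graph π) 1 (.block b) .y := .of_adj (Edge.yBlock b).adj_symm
  rcases u with _ | _ | _ | i | b | b | b | b | b | j | ⟨b, f⟩ | C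
  case yLeaf => exact ⟨1, by simp [clauseLevel], .of_adj Edge.yLeaf.adj_symm⟩
  case zLeaf => exact absurd rfl (hz i)
  case blockLeaf => exact ⟨2, le_rfl, (hasWalk_block_blockLeaf b).symm.trans (block_y b)⟩
  case link =>
    exact ⟨3, le_rfl, (hasWalk_link_guard b).trans ((hasWalk_guard_block b).trans (block_y b))⟩
  case guard => exact ⟨2, le_rfl, (hasWalk_guard_block b).trans (block_y b)⟩
  case assignment =>
    obtain ⟨j, hj⟩ := hat b f
    exact ⟨2, le_rfl, .cons (Edge.assignmentValue b f j hj).adj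
      (.of_adj (Edge.yValue j).adj_symm)⟩
  all_goals cases hu

theorem close_yLeaf (hat : ∀ b f, ∃ j, D.sat b f j) (C : Γ) (hu : (slot u).isSome)
    (hz : ∀ i, u ≠ .zLeaf i) : D.Close C .yLeaf u := by
  obtain ⟨k, hk, huy⟩ := exists_hasWalk_y hat C hu hz
  refine .of_hub (.of_adj Edge.yLeaf.adj_symm) huy ?_
  rw [show clauseLevel C (.yLeaf : GadgetVertex β α τ Γ π) = 3 from rfl]
  omega

theorem exists_hasWalk_block (C : Γ) {b b' : β}
    (hu : u = .blockLeaf b' ∨ u = .link b' ∨ u = .guard b' ∨ b' ≠ b ∧ ∃ f, u = .assignment b' f) :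
    ∃ k ≤ clauseLevel C u, HasWalk (D.graph π) k u (.block b) := by
  obtain ⟨k, hk, hwalk⟩ : ∃ k ≤ 1, HasWalk (D.graph π) k (.block b') (.block b) := by
    by_cases h : b' = b
    · exact ⟨0, zero_le_one, h ▸ .refl _⟩
    · exact ⟨1, le_rfl, .of_adj (Edge.blockBlock b' b h).adj⟩
  rcases hu with rfl | rfl | rfl | ⟨hb, f, rfl⟩
  · exact ⟨1 + k, Nat.add_le_add_left hk 1, (hasWalk_block_blockLeaf b').symm.trans hwalk⟩
  · exact ⟨2 + k, Nat.add_le_add_left hk 2,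
      ((hasWalk_link_guard b').trans (hasWalk_guard_block b')).trans hwalk⟩
  · exact ⟨1 + k, Nat.add_le_add_left hk 1, (hasWalk_guard_block b').trans hwalk⟩
  · exact ⟨2, le_rfl, .cons (Edge.assignmentDetour b' b f hb).adj
      (.of_adj (Edge.blockDetour b).adj_symm)⟩

theorem close_block (C : Γ) {b b' : β} (hs : s = .blockLeaf b ∨ s = .guard b)
    (ht : t = .blockLeaf b' ∨ t = .link b' ∨ t = .guard b' ∨ b' ≠ b ∧ ∃ f, t = .assignment b' f) :
    D.Close C s t := by
  obtain ⟨k, hk, htb⟩ := exists_hasWalk_block (D := D) C ht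
  have hle : 1 + k < 2 + clauseLevel C t := by omega
  rcases hs with rfl | rfl
  · exact .of_hub (hasWalk_block_blockLeaf b).symm htb hle
  · exact .of_hub (hasWalk_guard_block b) htb hle

theorem close_guard_assignment (C : Γ) (b b' : β) (f : α) :
    D.Close C (.guard b : GadgetVertex β α τ Γ π) (.assignment b' f) := by
  by_cases h : b' = b
  · subst h
    exact .of_hub (hasWalk_link_guard b').symm (hasWalk_assignment_link b' f)
      (by simp [clauseLevel])
  · exact close_block C (.inr rfl) (.inr (.inr (.inr ⟨h, f, rfl⟩)))

theorem exists_hasWalk_z_of_slot [Nonempty α] (C : Γ) {b : β}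
    (hu : u = .link b ∨ ∃ f, u = .assignment b f) :
    ∃ k < clauseLevel C u, HasWalk (D.graph π) k u .z := by
  obtain ⟨f⟩ := ‹Nonempty α›
  rcases hu with rfl | ⟨g, rfl⟩
  · exact ⟨2, by simp [clauseLevel],
      .cons (Edge.linkAssignment b f).adj (.of_adj (Edge.zAssignment b f).adj_symm)⟩
  · exact ⟨1, by simp [clauseLevel], .of_adj (Edge.zAssignment b g).adj_symm⟩

theorem close_link_or_assignment [Nonempty α] (C : Γ) {b b' : β}
    (hs : s = .link b ∨ ∃ f, s = .assignment b f) (ht : t = .link b' ∨ ∃ f, t = .assignment b' f) :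
    D.Close C s t := by
  obtain ⟨k, hk, hsz⟩ := exists_hasWalk_z_of_slot C hs
  obtain ⟨l, hl, htz⟩ := exists_hasWalk_z_of_slot C ht
  exact .of_hub hsz htz (by omega)

theorem close_of_slot [Nontrivial β] [Nonempty α] (hat : ∀ b f, ∃ j, D.sat b f j) (C : Γ)
    (hs : (slot s).isSome) (ht : (slot t).isSome)
    (hst : ∀ b f, s = .assignment b f → t ≠ .blockLeaf b)
    (hts : ∀ b f, t = .assignment b f → s ≠ .blockLeaf b) : D.Close C s t := by
  by_cases hsz : ∃ i, s = .zLeaf i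
  · obtain ⟨i, rfl⟩ := hsz
    exact close_zLeaf hat C i ht
  by_cases htz : ∃ i, t = .zLeaf i
  · obtain ⟨i, rfl⟩ := htz
    exact (close_zLeaf hat C i hs).symm
  rw [not_exists] at hsz htz
  by_cases hsy : s = .yLeaf
  · exact hsy ▸ close_yLeaf hat C ht htz
  by_cases hty : t = .yLeaf
  · exact (hty ▸ close_yLeaf hat C hs hsz).symm
  have place (u : GadgetVertex β α τ Γ π) (hu : (slot u).isSome) (hz : ∀ i, u ≠ .zLeaf i)
      (hy : u ≠ .yLeaf) : ∃ b, u = .blockLeaf b ∨ u = .link b ∨ u = .guard b ∨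
        ∃ f, u = .assignment b f := by
    cases u <;> simp_all [slot]
  obtain ⟨b, hsb⟩ := place s hs hsz hsy
  obtain ⟨b', htb⟩ := place t ht htz hty
  rcases hsb with rfl | rfl | rfl | ⟨f, rfl⟩
  · refine close_block C (.inl rfl) (htb.imp_right (.imp_right (.imp_right fun ⟨f, hf⟩ => ?_)))
    exact ⟨fun h => hts b f (h ▸ hf) rfl, f, hf⟩
  · rcases htb with rfl | rfl | rfl | htb
    · exact (close_block C (.inl rfl) (.inr (.inl rfl))).symm
    · exact close_link_or_assignment C (.inl rfl) (.inl rfl)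
    · exact (close_block C (.inr rfl) (.inr (.inl rfl))).symm
    · exact close_link_or_assignment C (.inl rfl) (.inr htb)
  · rcases htb with rfl | rfl | rfl | ⟨f, rfl⟩
    · exact close_block C (.inr rfl) (.inl rfl)
    · exact close_block C (.inr rfl) (.inr (.inl rfl))
    · exact close_block C (.inr rfl) (.inr (.inr (.inl rfl)))
    · exact close_guard_assignment C b b' f
  · rcases htb with rfl | rfl | rfl | htb
    · exact (close_block C (.inl rfl)
        (.inr (.inr (.inr ⟨fun h => hst b f rfl (congrArg _ h.symm), f, rfl⟩)))).symm
    · exact close_link_or_assignment C (.inr ⟨f, rfl⟩) (.inl rfl)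
    · exact (close_guard_assignment C b' b f).symm
    · exact close_link_or_assignment C (.inr ⟨f, rfl⟩) (.inr htb)

theorem inBlock_of_hasWalk_blockLeaf {C : Γ} {b : β}
    (h : HasWalk (D.graph π) 2 (.clause C) (.blockLeaf b)) : D.inBlock C b := by
  obtain ⟨u, hu, h⟩ := hasWalk_succ.1 h
  obtain ⟨v, hv, h⟩ := hasWalk_succ.1 h
  obtain rfl := hasWalk_zero.1 h
  rcases hv with hv | hv <;> cases hv
  rcases hu with hu | hu <;> cases hu
  assumption

theorem exists_sat_of_hasWalk_clause {C : Γ} {b : β} {f : α}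
    (h : HasWalk (D.graph π) 2 (.assignment b f) (.clause C)) :
    ∃ j, D.inValue C j ∧ D.sat b f j := by
  obtain ⟨u, hu, h⟩ := hasWalk_succ.1 h
  obtain ⟨v, hv, h⟩ := hasWalk_succ.1 h
  obtain rfl := hasWalk_zero.1 h
  rcases hv with hv | hv <;> cases hv <;> rcases hu with hu | hu <;> cases hu
  exact ⟨_, ‹_›, ‹_›⟩

theorem sat_of_onShortestPath_clause {C : Γ} {b : β} {f : α}
    (h : (D.graph π).OnShortestPath (.assignment b f) (.blockLeaf b) (.clause C)) :
    D.inBlock C b ∧ ∃ j, D.inValue C j ∧ D.sat b f j := by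
  obtain ⟨k, l, hk, hl, hmin⟩ := onShortestPath_iff_hasWalk.1 h
  have hk2 : 2 ≤ k := clauseLevel_le hk.symm
  have hl2 : 2 ≤ l := clauseLevel_le hl
  have hkl : k + l ≤ 4 := hmin 4 <| (hasWalk_assignment_link b f).trans <|
    (hasWalk_link_guard b).trans <| (hasWalk_guard_block b).trans (hasWalk_block_blockLeaf b)
  obtain rfl : k = 2 := by omega
  obtain rfl : l = 2 := by omega
  exact ⟨inBlock_of_hasWalk_blockLeaf hl, exists_sat_of_hasWalk_clause hk⟩

theorem leaf_mem {S : Set (GadgetVertex β α τ Γ π)}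
    (hS : (D.graph π).IsGeodeticSet S) :
    .yLeaf ∈ S ∧ (∀ i, .zLeaf i ∈ S) ∧ ∀ b, .blockLeaf b ∈ S := by
  refine ⟨?_, fun i => ?_, fun b => ?_⟩ <;>
    refine mem_of_isGeodeticSet_of_subsingleton_neighborSet hS ?_ <;>
    rintro _ (h | h) _ (h' | h') <;> cases h <;> cases h' <;> rfl

theorem satisfiable_of_isGeodeticSet [Fintype β] [Fintype π] [Nontrivial β] [Nonempty α]
    (hat : ∀ b f, ∃ j, D.sat b f j) {S : Finset (GadgetVertex β α τ Γ π)}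
    (hS : (D.graph π).IsGeodeticSet (S : Set (GadgetVertex β α τ Γ π)))
    (hcard : S.card ≤ 1 + Fintype.card π + 2 * Fintype.card β) : D.Satisfiable := by
  classical
  obtain ⟨hy, hz, hb⟩ := leaf_mem hS
  obtain ⟨hslot, hinj⟩ := isSome_and_injOn_of_card_le (S := S) (f := slot)
    (by
      rintro ((_ | i) | b | b)
      exacts [⟨_, hy, rfl⟩, ⟨_, hz i, rfl⟩, ⟨_, hb b, rfl⟩, exists_mem_slot hS b])
    (by simp only [Fintype.card_sum, Fintype.card_option]; omega)
  obtain ⟨f, hf⟩ : ∃ f : β → α, ∀ b g, .assignment b g ∈ S → g = f b := by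
    refine ⟨fun b => if h : ∃ g, .assignment b g ∈ S then h.choose else Classical.arbitrary α,
      fun b g hg => ?_⟩
    have h : ∃ g, .assignment b g ∈ S := ⟨g, hg⟩
    simp only [dif_pos h]
    cases hinj hg h.choose_spec rfl
    rfl
  refine ⟨f, fun C => ?_⟩
  obtain ⟨s, hs, t, ht, hst⟩ := hS (.clause C)
  by_cases h : ∃ b g, s = .assignment b g ∧ t = .blockLeaf b
  · obtain ⟨b, g, rfl, rfl⟩ := h
    obtain rfl := hf b g hs
    exact ⟨b, sat_of_onShortestPath_clause hst⟩
  by_cases h' : ∃ b g, t = .assignment b g ∧ s = .blockLeaf b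
  · obtain ⟨b, g, rfl, rfl⟩ := h'
    obtain rfl := hf b g ht
    exact ⟨b, sat_of_onShortestPath_clause (onShortestPath_symm hst)⟩
  refine absurd hst (close_of_slot hat C (hslot s hs) (hslot t ht) ?_ ?_).not_onShortestPath
  · exact fun b g hs ht => h ⟨b, g, hs, ht⟩
  · exact fun b g ht hs => h' ⟨b, g, ht, hs⟩

theorem exists_isGeodeticSet_iff [Fintype β] [Fintype π] [Nonempty π] [Nontrivial β] [Nonempty α]
    (hat : ∀ b f, ∃ j, D.sat b f j) (hta : ∀ j, ∃ b f, D.sat b f j) :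
    (∃ S : Finset (GadgetVertex β α τ Γ π), S.card ≤ 1 + Fintype.card π + 2 * Fintype.card β ∧
      (D.graph π).IsGeodeticSet (S : Set (GadgetVertex β α τ Γ π))) ↔ D.Satisfiable := by
  classical
  refine ⟨fun ⟨S, hcard, hS⟩ => satisfiable_of_isGeodeticSet hat hS hcard, fun ⟨f, hC⟩ => ?_⟩
  refine ⟨Finset.univ.image fun x : Option π ⊕ β ⊕ β =>
    x.elim (·.elim .yLeaf .zLeaf) (·.elim .blockLeaf fun b => .assignment b (f b)),
    Finset.card_image_le.trans ?_, isGeodeticSet_of_choice f ?_ ?_ ?_ ?_ hat hta hC⟩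
  · simp only [Finset.card_univ, Fintype.card_sum, Fintype.card_option]
    omega
  all_goals simp [Option.exists]

/-! ### The vertex cover -/

theorem vertexCoverNum_graph_le [Fintype β] [Fintype τ] :
    (D.graph π).vertexCoverNum ≤ (2 + 3 * Fintype.card β + Fintype.card τ : ℕ) := by
  classical
  let c : Bool ⊕ (β ⊕ β ⊕ β) ⊕ τ → GadgetVertex β α τ Γ π :=
    Sum.elim (cond · .y .z) (Sum.elim (Sum.elim .block (Sum.elim .detour .link)) .value)
  have hcover : (D.graph π).IsVertexCover (Set.range c) := by
    rintro u v (h | h) <;> cases h <;> simp [c]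
  calc
    (D.graph π).vertexCoverNum ≤ (Set.range c).encard := hcover.vertexCoverNum_le
    _ ≤ (Set.univ : Set (Bool ⊕ (β ⊕ β ⊕ β) ⊕ τ)).encard :=
      Set.image_univ (f := c) ▸ Set.encard_image_le c Set.univ
    _ = (2 + 3 * Fintype.card β + Fintype.card τ : ℕ) := by
      rw [Set.encard_univ, ENat.card_eq_coe_fintype_card]
      simp only [Fintype.card_sum, Fintype.card_bool]
      congr 1
      ring

end ChoicePattern

/-! ### Numbering the vertices -/

/-- The vertices of a gadget graph by kind: `y`, `z` and `yLeaf`, the leaves at `z`, five vertices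
for every block, and the vertices for values, assignments and clauses. -/
def GadgetVertex.equivSum (β α τ Γ π : Type*) :
    GadgetVertex β α τ Γ π ≃ ((((Fin 3 ⊕ π) ⊕ Fin 5 × β) ⊕ τ) ⊕ β × α) ⊕ Γ where
  toFun
    | .z => .inl (.inl (.inl (.inl (.inl 0))))
    | .y => .inl (.inl (.inl (.inl (.inl 1))))
    | .yLeaf => .inl (.inl (.inl (.inl (.inl 2))))
    | .zLeaf i => .inl (.inl (.inl (.inl (.inr i))))
    | .block b => .inl (.inl (.inl (.inr (0, b))))
    | .detour b => .inl (.inl (.inl (.inr (1, b))))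
    | .blockLeaf b => .inl (.inl (.inl (.inr (2, b))))
    | .link b => .inl (.inl (.inl (.inr (3, b))))
    | .guard b => .inl (.inl (.inl (.inr (4, b))))
    | .value j => .inl (.inl (.inr j))
    | .assignment b f => .inl (.inr (b, f))
    | .clause C => .inr C
  invFun
    | .inl (.inl (.inl (.inl (.inl 0)))) => .z
    | .inl (.inl (.inl (.inl (.inl 1)))) => .y
    | .inl (.inl (.inl (.inl (.inl 2)))) => .yLeaf
    | .inl (.inl (.inl (.inl (.inr i)))) => .zLeaf i
    | .inl (.inl (.inl (.inr (0, b)))) => .block b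
    | .inl (.inl (.inl (.inr (1, b)))) => .detour b
    | .inl (.inl (.inl (.inr (2, b)))) => .blockLeaf b
    | .inl (.inl (.inl (.inr (3, b)))) => .link b
    | .inl (.inl (.inl (.inr (4, b)))) => .guard b
    | .inl (.inl (.inr j)) => .value j
    | .inl (.inr (b, f)) => .assignment b f
    | .inr C => .clause C
  left_inv u := by cases u <;> rfl
  right_inv := by rintro (((((i | _) | ⟨i, _⟩) | _) | _) | _) <;>
    first | rfl | (fin_cases i <;> rfl)

namespace Partitioned3SAT

/-- The vertices of the graph for an instance with `m` clauses, the three parts of which are split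
into `s` blocks of `s` variables (some of them possibly dummies); a block is named by its part and
its number, a variable of a block by its part and its position. The assignments of a block are the
numbers below `2 ^ s`, in binary. -/
abbrev Vertex (s m : ℕ) : Type :=
  GadgetVertex (Fin 3 × Fin s) (Fin (2 ^ s)) ((Fin 3 × Fin s) × Bool) (Fin m) (Fin (4 * s - 1))

/-- The number of vertices of the graph. -/
def graphOrder (s m : ℕ) : ℕ := 25 * s + 2 + 3 * s * 2 ^ s + m

/-- The position of a vertex in the numbering of the vertices. -/
@[simp] def index {s m : ℕ} : Vertex s m → ℕ
  | .z => 0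
  | .y => 1
  | .yLeaf => 2
  | .zLeaf i => 3 + i
  | .block b => 4 * s + 2 + finProdFinEquiv b
  | .detour b => 7 * s + 2 + finProdFinEquiv b
  | .blockLeaf b => 10 * s + 2 + finProdFinEquiv b
  | .link b => 13 * s + 2 + finProdFinEquiv b
  | .guard b => 16 * s + 2 + finProdFinEquiv b
  | .value j => 19 * s + 2 + (2 * finProdFinEquiv j.1 + j.2.toNat)
  | .assignment b f => 25 * s + 2 + (finProdFinEquiv b * 2 ^ s + f)
  | .clause C => 25 * s + 2 + 3 * s * 2 ^ s + C

/-- The numbering of the vertices. -/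
def numbering (s m : ℕ) [NeZero s] : Vertex s m ≃ Fin (graphOrder s m) :=
  let pairs {a b : ℕ} {β : Type} (e : β ≃ Fin b) : Fin a × β ≃ Fin (a * b) :=
    (Equiv.prodCongr (.refl _) e).trans finProdFinEquiv
  let blocks : Fin 3 × Fin s ≃ Fin (3 * s) := finProdFinEquiv
  let values := (Equiv.prodCongr blocks finTwoEquiv.symm).trans finProdFinEquiv
  let assignments := (Equiv.prodCongr blocks (.refl (Fin (2 ^ s)))).trans finProdFinEquiv
  let sum {α β : Type} {a b : ℕ} (e : α ≃ Fin a) (e' : β ≃ Fin b) : α ⊕ β ≃ Fin (a + b) :=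
    (Equiv.sumCongr e e').trans finSumFinEquiv
  (GadgetVertex.equivSum ..).trans <|
    (sum (sum (sum (sum (sum (.refl _) (.refl _)) (pairs blocks)) values) assignments)
      (.refl _)).trans <|
    finCongr <| by
      have := NeZero.pos s
      rw [graphOrder]
      omega

@[simp] theorem numbering_val {s m : ℕ} [NeZero s] (u : Vertex s m) :
    (numbering s m u : ℕ) = index u := by
  have := NeZero.pos s
  rcases u with _ | _ | _ | _ | _ | _ | _ | _ | _ | ⟨_, _ | _⟩ | _ | _ <;>
    simp only [numbering, GadgetVertex.equivSum, finTwoEquiv, index, Equiv.trans_apply,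
      Equiv.coe_trans, Equiv.symm_mk, Equiv.coe_fn_mk, Equiv.sumCongr_apply, Equiv.prodCongr_apply,
      Equiv.coe_refl, Function.comp_apply, Sum.map_inl, Sum.map_inr, Prod.map_apply, id_eq,
      cond_true, cond_false, finSumFinEquiv_apply_left, finSumFinEquiv_apply_right,
      finProdFinEquiv_apply_val, finCongr_apply, Fin.val_cast, Fin.val_castAdd, Fin.val_natAdd,
      Fin.coe_ofNat_eq_mod, Bool.toNat_true, Bool.toNat_false] <;>
    ring_nf <;> omega

/-! ### Truth assignments in blocks -/

/-- The choice pattern of an instance. The variable with index `i` of a part is the variable with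
position `i % s` in the block with number `i / s`. -/
def blockPattern (ψ : Partitioned3SAT) (s : ℕ) : ChoicePattern (Fin 3 × Fin s) (Fin (2 ^ s))
    ((Fin 3 × Fin s) × Bool) (Fin ψ.clauses.length) where
  sat b f j := b.1 = j.1.1 ∧ (f : ℕ).testBit j.1.2 = j.2
  inBlock c b := ∃ l ∈ ψ.clauses[c], b.1 = l.part ∧ (b.2 : ℕ) = l.idx / s
  inValue c j := ∃ l ∈ ψ.clauses[c], j.1.1 = l.part ∧ (j.1.2 : ℕ) = l.idx % s ∧ j.2 = l.sign

section BlockPattern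

variable {ψ : Partitioned3SAT} {s : ℕ}

theorem exists_testBit_eq (f : Fin s → Bool) :
    ∃ a : Fin (2 ^ s), ∀ j : Fin s, (a : ℕ).testBit j = f j :=
  ⟨⟨Nat.ofBits f, Nat.ofBits_lt_two_pow f⟩, fun j => Nat.testBit_ofBits_lt f j j.2⟩

theorem exists_sat_of_assignment [NeZero s] (b : Fin 3 × Fin s) (f : Fin (2 ^ s)) :
    ∃ j, (ψ.blockPattern s).sat b f j :=
  ⟨((b.1, 0), (f : ℕ).testBit 0), rfl, rfl⟩

theorem exists_sat_of_value [NeZero s] (j : (Fin 3 × Fin s) × Bool) :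
    ∃ b f, (ψ.blockPattern s).sat b f j :=
  let ⟨f, hf⟩ := exists_testBit_eq fun _ => j.2
  ⟨(j.1.1, 0), f, rfl, hf j.1.2⟩

theorem satisfiable_blockPattern_iff [NeZero s] (h : ψ.n ≤ s * s) :
    (ψ.blockPattern s).Satisfiable ↔ ψ.Satisfiable := by
  let quot (i : Fin ψ.n) : Fin s := ⟨i / s, Nat.div_lt_of_lt_mul (i.2.trans_le h)⟩
  let rem (i : Fin ψ.n) : Fin s := ⟨i % s, Nat.mod_lt _ (NeZero.pos s)⟩
  constructor
  · rintro ⟨f, hf⟩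
    refine ⟨fun δ i => (f (δ, quot i) : ℕ).testBit (rem i), fun C hC => ?_⟩
    obtain ⟨c, hc, rfl⟩ := List.getElem_of_mem hC
    obtain ⟨⟨δ, b⟩, ⟨l, hl, hδ, hb⟩, ⟨⟨δ', j⟩, v⟩, ⟨l', hl', hδ', hj, hv⟩, rfl, hsat⟩ := hf ⟨c, hc⟩
    have hidx : l.idx = l'.idx := ψ.partitioned _ hC l hl l' hl' (hδ.symm.trans hδ')
    obtain rfl : b = quot l'.idx := Fin.ext (hidx ▸ hb)
    obtain rfl : j = rem l'.idx := Fin.ext hj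
    obtain rfl : δ = l'.part := hδ'
    exact ⟨l', hl', hsat.trans hv⟩
  · rintro ⟨τ, hτ⟩
    choose f hf using fun b : Fin 3 × Fin s => exists_testBit_eq fun j : Fin s =>
      if hi : s * b.2 + j < ψ.n then τ b.1 ⟨s * b.2 + j, hi⟩ else false
    refine ⟨f, fun c => ?_⟩
    obtain ⟨l, hl, hsign⟩ := hτ _ (ψ.clauses.get_mem c)
    refine ⟨(l.part, quot l.idx), ⟨l, hl, rfl, rfl⟩,
      ((l.part, rem l.idx), l.sign), ⟨l, hl, rfl, rfl, rfl⟩, rfl, (hf _ _).trans ?_⟩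
    simp only [quot, rem, Nat.div_add_mod, l.idx.2, dif_pos, hsign]

theorem sat_blockPattern_iff {b : Fin 3 × Fin s} {f : Fin (2 ^ s)} {j : (Fin 3 × Fin s) × Bool} :
    (ψ.blockPattern s).sat b f j ↔ ∃ i : Fin s, j = ((b.1, i), (f : ℕ).testBit i) := by
  constructor
  · rintro ⟨h, h'⟩
    exact ⟨j.1.2, Prod.ext (Prod.ext h.symm rfl) h'.symm⟩
  · rintro ⟨i, rfl⟩
    exact ⟨rfl, rfl⟩

theorem inBlock_blockPattern_iff (h : ψ.n ≤ s * s) {c : Fin ψ.clauses.length} {b : Fin 3 × Fin s} :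
    (ψ.blockPattern s).inBlock c b ↔ ∃ i : Fin ψ.clauses[c].length,
      b = (ψ.clauses[c][i].part, (ψ.clauses[c][i].idx.castLE h).divNat) := by
  constructor
  · rintro ⟨l, hl, hδ, hb⟩
    obtain ⟨i, rfl⟩ := List.get_of_mem hl
    exact ⟨i, Prod.ext hδ (Fin.ext hb)⟩
  · rintro ⟨i, rfl⟩
    exact ⟨_, List.getElem_mem i.2, rfl, rfl⟩

theorem inValue_blockPattern_iff (h : ψ.n ≤ s * s) {c : Fin ψ.clauses.length}
    {j : (Fin 3 × Fin s) × Bool} :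
    (ψ.blockPattern s).inValue c j ↔ ∃ i : Fin ψ.clauses[c].length,
      j = ((ψ.clauses[c][i].part, (ψ.clauses[c][i].idx.castLE h).modNat),
        ψ.clauses[c][i].sign) := by
  constructor
  · rintro ⟨l, hl, hδ, hj, hv⟩
    obtain ⟨i, rfl⟩ := List.get_of_mem hl
    exact ⟨i, Prod.ext (Prod.ext hδ (Fin.ext hj)) hv⟩
  · rintro ⟨i, rfl⟩
    exact ⟨_, List.getElem_mem i.2, rfl, rfl, rfl⟩

end BlockPattern

/-- The number of variables in a block, which is `⌈√n⌉` for positive `n`. -/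
def blockSize (n : ℕ) : ℕ := Nat.sqrt (n - 1) + 1

instance (n : ℕ) : NeZero (blockSize n) := ⟨Nat.succ_ne_zero _⟩

theorem le_blockSize_mul_self (n : ℕ) : n ≤ blockSize n * blockSize n := by
  have : n - 1 < blockSize n * blockSize n := Nat.lt_succ_sqrt (n - 1)
  omega

/-! ### The instance of Geodetic Set and its size -/

theorem blockSize_eq {n : ℕ} (hn : 0 < n) : blockSize n = ⌈√(n : ℝ)⌉₊ := by
  refine ((Nat.ceil_eq_iff (Nat.succ_ne_zero _)).2 ⟨Real.lt_sqrt_of_sq_lt ?_, ?_⟩).symm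
  · have : Nat.sqrt (n - 1) ^ 2 < n := (Nat.sqrt_le' _).trans_lt (by omega)
    exact_mod_cast this
  · refine (Real.sqrt_le_left (Nat.cast_nonneg _)).2 ?_
    rw [pow_two]
    exact_mod_cast le_blockSize_mul_self n

/-- The instance of Geodetic Set to which an instance of 3-Partitioned-3-SAT is reduced. -/
noncomputable def geodeticInstance (ψ : Partitioned3SAT) : GeodeticSetInstance where
  order := graphOrder (blockSize ψ.n) ψ.clauses.length
  graph := ((ψ.blockPattern _).graph (Fin (4 * blockSize ψ.n - 1))).comap (numbering _ _).symm
  k := 10 * blockSize ψ.n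
  k_pos := Nat.mul_pos (by norm_num) (NeZero.pos _)

variable (ψ : Partitioned3SAT)

/-- The numbering of the vertices, as an isomorphism. -/
noncomputable def geodeticInstanceIso : ψ.geodeticInstance.graph ≃g
    (ψ.blockPattern (blockSize ψ.n)).graph (Fin (4 * blockSize ψ.n - 1)) :=
  .comap (numbering _ _).symm _

theorem isYes_geodeticInstance_iff : ψ.geodeticInstance.IsYes ↔ ψ.Satisfiable := by
  have hs : 0 < blockSize ψ.n := NeZero.pos _
  have : Nonempty (Fin (4 * blockSize ψ.n - 1)) := ⟨⟨0, by omega⟩⟩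
  have hk : ψ.geodeticInstance.k = 1 + Fintype.card (Fin (4 * blockSize ψ.n - 1)) +
      2 * Fintype.card (Fin 3 × Fin (blockSize ψ.n)) := by
    simp only [geodeticInstance, Fintype.card_prod, Fintype.card_fin]
    omega
  rw [← satisfiable_blockPattern_iff (le_blockSize_mul_self ψ.n),
    ← ChoicePattern.exists_isGeodeticSet_iff (π := Fin (4 * blockSize ψ.n - 1))
      exists_sat_of_assignment exists_sat_of_value, ← hk]
  exact ⟨exists_isGeodeticSet_of_iso ψ.geodeticInstanceIso,
    exists_isGeodeticSet_of_iso ψ.geodeticInstanceIso.symm⟩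

theorem vc_geodeticInstance_le : ψ.geodeticInstance.vc ≤ 15 * blockSize ψ.n + 2 := by
  refine ENat.toNat_le_of_le_natCast ?_
  rw [SimpleGraph.vertexCoverNum_congr ψ.geodeticInstanceIso]
  refine ChoicePattern.vertexCoverNum_graph_le.trans_eq ?_
  simp only [Fintype.card_prod, Fintype.card_fin, Fintype.card_bool]
  congr 1
  ring

theorem vc_add_k_geodeticInstance_le :
    ψ.geodeticInstance.vc + ψ.geodeticInstance.k ≤ 27 * blockSize ψ.n := by
  have hk : ψ.geodeticInstance.k = 10 * blockSize ψ.n := rfl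
  have hvc := ψ.vc_geodeticInstance_le
  have hs : 0 < blockSize ψ.n := NeZero.pos _
  omega

theorem length_clauses_le : ψ.clauses.length ≤ (6 * ψ.n + 1) ^ 3 := by
  classical
  let F (C : List (PartLiteral ψ.n)) (i : Fin 3) : Option (Fin 3 × Fin ψ.n × Bool) :=
    C[(i : ℕ)]?.map fun l => (l.part, l.idx, l.sign)
  have hF : Set.InjOn F ψ.clauses.toFinset := by
    intro C hC D hD h
    rw [Finset.mem_coe, List.mem_toFinset] at hC hD
    refine List.ext_getElem? fun i => ?_
    by_cases hi : i < 3
    · refine Option.map_injective (f := fun l : PartLiteral ψ.n => (l.part, l.idx, l.sign)) ?_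
        (congrFun h ⟨i, hi⟩)
      rintro ⟨a, b, c⟩ ⟨a', b', c'⟩ h
      simpa using h
    · have := ψ.length_le C hC
      have := ψ.length_le D hD
      rw [List.getElem?_eq_none (by omega), List.getElem?_eq_none (by omega)]
  calc ψ.clauses.length = ψ.clauses.toFinset.card := (List.toFinset_card_of_nodup ψ.nodup).symm
    _ ≤ Fintype.card (Fin 3 → Option (Fin 3 × Fin ψ.n × Bool)) :=
      Finset.card_le_card_of_injOn F (by simp) hF
    _ = (6 * ψ.n + 1) ^ 3 := by
      simp only [Fintype.card_fun, Fintype.card_option, Fintype.card_prod, Fintype.card_fin,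
        Fintype.card_bool]
      ring

theorem order_geodeticInstance_le : ψ.geodeticInstance.order ≤ 2 ^ (15 * blockSize ψ.n) := by
  change graphOrder (blockSize ψ.n) _ ≤ _
  set s := blockSize ψ.n
  have hs : 0 < s := NeZero.pos _
  have hn : ψ.n ≤ s * s := le_blockSize_mul_self ψ.n
  have hpow : s ≤ 2 ^ s := Nat.lt_two_pow_self.le
  have hclauses : ψ.clauses.length ≤ 343 * 2 ^ (6 * s) :=
    calc ψ.clauses.length ≤ (6 * ψ.n + 1) ^ 3 := ψ.length_clauses_le
      _ ≤ (7 * (s * s)) ^ 3 := by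
        have : 0 < s * s := by positivity
        gcongr
        omega
      _ = 343 * s ^ 6 := by ring
      _ ≤ 343 * (2 ^ s) ^ 6 := by gcongr
      _ = 343 * 2 ^ (6 * s) := by rw [← pow_mul, mul_comm s]
  have hassignments : s * 2 ^ s ≤ 2 ^ (6 * s) :=
    calc s * 2 ^ s ≤ 2 ^ s * 2 ^ s := by gcongr
      _ = 2 ^ (s + s) := (pow_add _ _ _).symm
      _ ≤ 2 ^ (6 * s) := by gcongr <;> omega
  have hself : s ≤ s * 2 ^ s := Nat.le_mul_of_pos_right s (by positivity)
  calc graphOrder s ψ.clauses.length ≤ 2 ^ 9 * 2 ^ (6 * s) := by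
        unfold graphOrder
        rw [mul_assoc 3]
        omega
    _ = 2 ^ (9 + 6 * s) := (pow_add _ _ _).symm
    _ ≤ 2 ^ (15 * s) := by gcongr <;> omega

theorem eval_le_eval_one_mul_pow (p : Polynomial ℕ) {x : ℕ} (hx : 1 ≤ x) :
    p.eval x ≤ p.eval 1 * x ^ p.natDegree := by
  rw [Polynomial.eval_eq_sum_range, Polynomial.eval_eq_sum_range, Finset.sum_mul]
  refine Finset.sum_le_sum fun i hi => ?_
  rw [one_pow, mul_one]
  gcongr
  exact Finset.mem_range_succ_iff.1 hi

theorem exists_eval_order_le (p : Polynomial ℕ) : ∃ e : ℕ, ∀ ψ : Partitioned3SAT,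
    p.eval ψ.geodeticInstance.order ≤ 2 ^ (e * blockSize ψ.n) := by
  refine ⟨p.eval 1 + 15 * p.natDegree, fun ψ => ?_⟩
  have horder : 1 ≤ ψ.geodeticInstance.order := by
    change 1 ≤ graphOrder _ _
    unfold graphOrder
    omega
  have hone : p.eval 1 ≤ 2 ^ (p.eval 1 * blockSize ψ.n) :=
    Nat.lt_two_pow_self.le.trans
      (Nat.pow_le_pow_right two_pos (Nat.le_mul_of_pos_right _ (NeZero.pos _)))
  calc p.eval ψ.geodeticInstance.order ≤ p.eval 1 * ψ.geodeticInstance.order ^ p.natDegree :=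
        eval_le_eval_one_mul_pow p horder
    _ ≤ 2 ^ (p.eval 1 * blockSize ψ.n) *
        (2 ^ (15 * blockSize ψ.n)) ^ p.natDegree := by
      gcongr
      exact ψ.order_geodeticInstance_le
    _ = 2 ^ ((p.eval 1 + 15 * p.natDegree) * blockSize ψ.n) := by
      rw [← pow_mul, ← pow_add]
      congr 1
      ring

variable {ψ}

theorem blockSize_le_two_mul_sqrt_numVars (hn : 0 < ψ.n) :
    (blockSize ψ.n : ℝ) ≤ 2 * √ψ.numVars := by
  have hone : 1 ≤ √(ψ.n : ℝ) := Real.one_le_sqrt.2 (by exact_mod_cast hn)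
  calc (blockSize ψ.n : ℝ) ≤ √ψ.n + 1 := by
        rw [blockSize_eq hn]
        exact (Nat.ceil_lt_add_one (Real.sqrt_nonneg _)).le
    _ ≤ 2 * √ψ.n := by linarith
    _ ≤ 2 * √ψ.numVars := by
      gcongr
      unfold numVars
      omega

theorem natCast_le_two_rpow (hn : 0 < ψ.n) {x e : ℕ} {c : ℝ}
    (hx : x ≤ 2 ^ (e * blockSize ψ.n)) (hc : 2 * e ≤ c) : (x : ℝ) ≤ 2 ^ (c * √ψ.numVars) :=
  calc (x : ℝ) ≤ 2 ^ (e * blockSize ψ.n) := by exact_mod_cast hx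
    _ = 2 ^ ((e : ℝ) * blockSize ψ.n) := by rw [← Real.rpow_natCast]; push_cast; rfl
    _ ≤ 2 ^ (c * √ψ.numVars) := by
      refine Real.rpow_le_rpow_of_exponent_le one_le_two ?_
      calc (e : ℝ) * blockSize ψ.n ≤ e * (2 * √ψ.numVars) := by
            gcongr
            exact blockSize_le_two_mul_sqrt_numVars hn
        _ = 2 * e * √ψ.numVars := by ring
        _ ≤ c * √ψ.numVars := by gcongr

end Partitioned3SAT

/-! ### Programs that enter edges into an adjacency matrix -/

namespace RAM

/-- The program fragments that compute a graph keep the input word in bank `0` and the matrix of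
the adjacencies `E` found so far in bank `1`, with the vertices in the order of `num`. -/
noncomputable def memory {V : Type*} {N : ℕ} (w : List ℕ) (num : V ≃ Fin N) (E : Set (V × V)) :
    ℕ → ℕ → ℕ
  | 0, i => w.getD i 0
  | 1, i => open Classical in if ∃ p ∈ E, i = num p.1 * N + num p.2 then 1 else 0
  | _, _ => 0

section Memory

variable {V : Type*} {N : ℕ} (w : List ℕ) (num : V ≃ Fin N)

theorem initial_mem : (initial w).mem = memory w num ∅ := by
  funext a i
  match a with
  | 0 | 1 | a + 2 => simp [initial, memory]

theorem memory_union_singleton (E : Set (V × V)) (u v : V) :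
    memory w num (E ∪ {(u, v)}) = Function.update (memory w num E) 1
      (Function.update (memory w num E 1) (num u * N + num v) 1) := by
  funext a i
  match a with
  | 0 | a + 2 => simp [memory]
  | 1 =>
    classical
    simp only [memory, Set.union_singleton, Set.exists_mem_insert, Function.update_self,
      Function.update_apply, ite_or]

open Classical in
theorem memory_one_apply (E : Set (V × V)) (u v : V) :
    memory w num E 1 (num u * N + num v) = if (u, v) ∈ E then 1 else 0 := by
  have hinj (p : V × V) : (num u * N + num v : ℕ) = num p.1 * N + num p.2 ↔ (u, v) = p := by
    refine ⟨fun h => ?_, by rintro rfl; rfl⟩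
    have := finProdFinEquiv.injective (a₁ := (num u, num v)) (a₂ := (num p.1, num p.2))
      (Fin.ext (by simpa [mul_comm, add_comm] using h))
    exact Prod.ext (by simpa using congrArg Prod.fst this) (by simpa using congrArg Prod.snd this)
  simp only [memory, hinj, exists_eq_right']

end Memory

/-- With the registers as in `ρ` before and as in `ρ'` after its run, the program `P` adds the
adjacencies in `F` to the matrix. -/
def Adds {V : Type*} {N : ℕ} (w : List ℕ) (num : V ≃ Fin N) (P : Com) (ρ ρ' : List ℕ)
    (F : Set (V × V)) : Prop :=
  ∀ E, Runs N P ⟨ρ, memory w num E, []⟩ ⟨ρ', memory w num (E ∪ F), []⟩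

/-- Runs `P` if the value of `e` is nonzero. -/
def Com.when (e : Exp) (P : Com) : Com := .ite e P .skip

/-- Runs `P 0`, `P 1` and `P 2`, one for each part of the set of variables. -/
def Com.forPart (P : Fin 3 → Com) : Com := P 0 ;; P 1 ;; P 2

/-- Makes the vertices with numbers `e` and `e'` adjacent, given the number of vertices in
register `3`. The registers `x` and `x + 1` are used for multiplication. -/
def Com.mark (x : ℕ) (e e' : Exp) : Com :=
  (.mul x e (.var 3) ;; .store 1 (.var x + e') 1) ;; .mul x e' (.var 3) ;; .store 1 (.var x + e) 1

namespace Adds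

variable {V : Type*} {N : ℕ} {w : List ℕ} {num : V ≃ Fin N} {P Q : Com} {ρ ρ' ρ'' : List ℕ}
  {F F' : Set (V × V)} {e e' : Exp} {a n x : ℕ} {p : Prop}

theorem seq (hP : Adds w num P ρ ρ' F) (hQ : Adds w num Q ρ' ρ'' F') :
    Adds w num (P ;; Q) ρ ρ'' (F ∪ F') := fun E =>
  (hP E).seq (Set.union_assoc E F F' ▸ hQ (E ∪ F))

theorem compute (hP : ∀ E, Runs N P ⟨ρ, memory w num E, []⟩ ⟨ρ', memory w num E, []⟩)
    (hQ : Adds w num Q ρ' ρ'' F) : Adds w num (P ;; Q) ρ ρ'' F := fun E =>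
  (hP E).seq (hQ E)

theorem scope (h : Adds w num P ρ ρ'' F) (hpre : ρ' <+: ρ'') : Adds w num P ρ ρ' F := by
  intro E σ hσ
  obtain ⟨t, τ, hP, ht, hτ⟩ := h E σ hσ
  exact ⟨t, τ, hP, ht, fun x hx => (hτ.reg x (hx.trans_le hpre.length_le)).trans
    (hpre.getElem hx).symm, hτ.mem, hτ.out⟩

theorem when (he : ∀ E, Evals ⟨ρ, memory w num E, []⟩ e a) (ha : a ≠ 0 ↔ p)
    (hP : p → Adds w num P ρ ρ F) : Adds w num (.when e P) ρ ρ (⋃ _ : p, F) := fun E =>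
  .ite (he E) (fun h => by simpa [ha.1 h] using hP (ha.1 h) E)
    fun h => by simpa [ha.not_right.1 h] using Runs.skip

theorem forPart {P : Fin 3 → Com} {F : Fin 3 → Set (V × V)} (h : ∀ δ, Adds w num (P δ) ρ ρ (F δ)) :
    Adds w num (.forPart P) ρ ρ (⋃ δ, F δ) := by
  have hF : ⋃ δ, F δ = F 0 ∪ (F 1 ∪ F 2) := by ext; simp [Fin.exists_fin_succ]
  exact hF ▸ (h 0).seq ((h 1).seq (h 2))

theorem count {ρ : ℕ → List ℕ} {F : Fin n → Set (V × V)} (hx : ∀ i, x = (ρ i).length)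
    (hn : n ≤ N) (he : ∀ i E, Evals ⟨ρ i, memory w num E, []⟩ e n)
    (hP : ∀ i : Fin n, Adds w num P (ρ i ++ [(i : ℕ)]) (ρ (i + 1) ++ [(i : ℕ)]) (F i)) :
    Adds w num (.count x e P) (ρ 0) (ρ n) (⋃ i, F i) := by
  intro E
  let found (i : ℕ) : Set (V × V) := ⋃ j : Fin n, ⋃ _ : j < i, F j
  have hzero : E = E ∪ found 0 := by simp [found]
  have hsucc (i : Fin n) : E ∪ found (i + 1) = E ∪ found i ∪ F i := by
    simp only [found, Nat.lt_succ_iff_lt_or_eq, Set.iUnion_or, Set.iUnion_union_distrib,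
      Set.union_assoc, Fin.val_inj, Set.iUnion_iUnion_eq_left]
  have hlast : found n = ⋃ i, F i := by simp [found]
  rw [hlast.symm]
  conv in memory w num E => rw [hzero]
  refine .count (v := fun i => ⟨ρ i, memory w num (E ∪ found i), []⟩) hx hn (fun i => he i _)
    fun i hi => ?_
  rw [hsucc ⟨i, hi⟩]
  exact hP ⟨i, hi⟩ _

theorem mark {u v : V} (he : ∀ E, Evals ⟨ρ, memory w num E, []⟩ e (num u))
    (he' : ∀ E, Evals ⟨ρ, memory w num E, []⟩ e' (num v)) (hN : ρ[3]? = some N)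
    (hx : x = ρ.length) : Adds w num (.mark x e e') ρ ρ {(u, v), (v, u)} := by
  have arc {u v : V} {e e' : Exp} (he : ∀ E, Evals ⟨ρ, memory w num E, []⟩ e (num u))
      (he' : ∀ E, Evals ⟨ρ, memory w num E, []⟩ e' (num v)) :
      Adds w num (.mul x e (.var 3) ;; .store 1 (.var x + e') 1) ρ ρ {(u, v)} := fun E => by
    have hvar : Evals ⟨ρ, memory w num E, []⟩ (.var 3) N := evals_var hN
    rw [memory_union_singleton]
    exact .pop (.seq (.mul (he E) hvar le_rfl hx)
      (.store ((evals_var_push hx).add (he' E).push) (evals_ofNat _ 1)))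
  exact (arc he he').seq (arc he' he)

end Adds

/-! ### The edges at blocks and assignments -/

open Partitioned3SAT

/-- Expressions for vertex numbers, given `s`, `2 ^ s`, the number of clauses and the number of
vertices in the registers `0` to `3`. Blocks, values, leaves and clauses are given by their numbers
among the vertices of the same kind, and `assignment _ e` by the number `e` of the pair. -/
@[simp] def code : GadgetVertex Exp Exp Exp Exp Exp → Exp
  | .z => 0
  | .y => 1
  | .yLeaf => 2
  | .zLeaf e => 3 + e
  | .block e => 4 • .var 0 + 2 + e
  | .detour e => 7 • .var 0 + 2 + e
  | .blockLeaf e => 10 • .var 0 + 2 + e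
  | .link e => 13 • .var 0 + 2 + e
  | .guard e => 16 • .var 0 + 2 + e
  | .value e => 19 • .var 0 + 2 + e
  | .assignment _ e => 25 • .var 0 + 2 + e
  | .clause e => .var 3 - .var 2 + e

/-- The number of the block with number `e` in the part `δ`. -/
@[simp] def Exp.block (δ : Fin 3) (e : Exp) : Exp := e + (δ : ℕ) • .var 0

/-- An expression that is nonzero if and only if `e` and `e'` differ. -/
@[simp] def Exp.diff (e e' : Exp) : Exp := (e - e') + (e' - e)

/-- Adds the edge between two vertices. -/
def Com.edge (x : ℕ) (u v : GadgetVertex Exp Exp Exp Exp Exp) : Com := .mark x (code u) (code v)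

/-- Runs `P δ` for all blocks of all parts `δ`, with the number of the block in the part in
register `x`. -/
def Com.forBlock (x : ℕ) (P : Fin 3 → Com) : Com := .forPart fun δ => .count x (.var 0) (P δ)

/-- The edges at the leaves of `y` and `z`. -/
def Com.leafEdges : Com :=
  .edge 4 .y .yLeaf ;; .count 4 (4 • .var 0 - 1) (.edge 5 .z (.zLeaf (.var 4)))

/-- The edges between `y` and the values. -/
def Com.valueEdges : Com := .forBlock 4 fun δ =>
  .edge 5 .y (.value (2 • .block δ (.var 4))) ;; .edge 5 .y (.value (2 • .block δ (.var 4) + 1))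

/-- The other edges between two vertices none of which is an assignment or a clause. -/
def Com.blockEdges : Com := .forBlock 4 fun δ =>
  let b := .block δ (.var 4)
  .edge 5 .y (.block b) ;; .edge 5 (.block b) (.detour b) ;; .edge 5 (.block b) (.blockLeaf b) ;;
  .edge 5 (.block b) (.guard b) ;; .edge 5 (.link b) (.guard b) ;;
  .forBlock 5 fun δ' =>
    .when (.diff b (.block δ' (.var 5))) (.edge 6 (.block b) (.block (.block δ' (.var 5))))

/-- The edges from an assignment to the values in it, given the numbers of the block, of the first
assignment of the block, and of the assignment in the block in the registers `4`, `5` and `6`.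
The bit of the assignment at the position in register `7` is computed in register `12`. -/
def Com.bitEdges (δ : Fin 3) : Com := .count 7 (.var 0) (
  .twoPow 8 (.var 7) ;; .divMod 9 (.var 6) (.var 8) ;; .divMod 11 (.var 9) 2 ;;
  .edge 13 (.assignment (.block δ (.var 4)) (.var 5 + .var 6))
    (.value (2 • .block δ (.var 7) + .var 12)))

/-- The edges at the assignments. -/
def Com.assignmentEdges : Com := .forBlock 4 fun δ =>
  let b := .block δ (.var 4)
  .mul 5 b (.var 1) ;; .count 6 (.var 1) (
    let f := .assignment b (.var 5 + .var 6)
    .edge 7 .z f ;; .edge 7 (.link b) f ;;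
    .forBlock 7 (fun δ' =>
      .when (.diff b (.block δ' (.var 7))) (.edge 8 f (.detour (.block δ' (.var 7))))) ;;
    .bitEdges δ)

/-- The ordered pairs that represent an edge. -/
def arcs {V : Type*} (u v : V) : Set (V × V) := {(u, v), (v, u)}

/-- The registers used in `code`. -/
@[simp] def env (s m : ℕ) : List ℕ := [s, 2 ^ s, m, graphOrder s m]

theorem diff_ne_zero_iff {s : ℕ} {b b' : Fin 3 × Fin s} :
    (finProdFinEquiv b - finProdFinEquiv b' : ℕ) + (finProdFinEquiv b' - finProdFinEquiv b) ≠ 0 ↔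
      b ≠ b' := by
  rw [← finProdFinEquiv.injective.ne_iff, Ne, Ne, Fin.ext_iff]
  omega

section Edges

variable {s m : ℕ} [NeZero s] {w : List ℕ}

theorem two_pow_le_graphOrder : 2 ^ s ≤ graphOrder s m := by
  have := Nat.le_mul_of_pos_left (2 ^ s) (Nat.mul_pos three_pos (NeZero.pos s))
  rw [graphOrder]
  omega

theorem Adds.edge {ρ : List ℕ} {x : ℕ} {e e' : GadgetVertex Exp Exp Exp Exp Exp}
    {u v : Vertex s m} (he : ∀ E, Evals ⟨ρ, memory w (numbering s m) E, []⟩ (code e) (index u))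
    (he' : ∀ E, Evals ⟨ρ, memory w (numbering s m) E, []⟩ (code e') (index v))
    (hN : ρ[3]? = some (graphOrder s m)) (hx : x = ρ.length) :
    Adds w (numbering s m) (.edge x e e') ρ ρ (arcs u v) :=
  .mark (by simpa only [numbering_val]) (by simpa only [numbering_val]) hN hx

theorem Adds.forBlock {ρ : List ℕ} {P : Fin 3 → Com} {x : ℕ}
    {F : Fin 3 × Fin s → Set (Vertex s m × Vertex s m)} (hs : ρ[0]? = some s) (hx : x = ρ.length)
    (h : ∀ b, Adds w (numbering s m) (P b.1) (ρ ++ [(b.2 : ℕ)]) (ρ ++ [(b.2 : ℕ)]) (F b)) :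
    Adds w (numbering s m) (.forBlock x P) ρ ρ (⋃ b, F b) := by
  rw [Set.iUnion_prod']
  exact .forPart fun δ => .count (ρ := fun _ => ρ) (fun _ => hx) (by rw [graphOrder]; omega)
    (fun _ _ => evals_var hs) fun i => h (δ, i)

theorem Adds.leafEdges : Adds w (numbering s m) .leafEdges (env s m) (env s m)
    (arcs .y .yLeaf ∪ ⋃ i, arcs .z (.zLeaf i)) := by
  refine .seq (.edge ?_ ?_ rfl rfl) (.count (ρ := fun _ => env s m) (fun _ => rfl) ?_ (fun _ => ?_)
    fun i => .edge ?_ ?_ rfl rfl)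
  case refine_3 => rw [graphOrder]; omega
  all_goals exact fun _ σ h => by simp [h.reg]

theorem Adds.valueEdges : Adds w (numbering s m) .valueEdges (env s m) (env s m)
    (⋃ b, (arcs .y (.value (b, false)) ∪ arcs .y (.value (b, true)))) := by
  refine .forBlock rfl rfl fun b => .seq (.edge ?_ ?_ rfl rfl) (.edge ?_ ?_ rfl rfl) <;>
    exact fun _ σ h => by simp [h.reg, mul_comm, add_assoc]

theorem Adds.blockEdges : Adds w (numbering s m) .blockEdges (env s m) (env s m)
    (⋃ b, (arcs .y (.block b) ∪ (arcs (.block b) (.detour b) ∪ (arcs (.block b) (.blockLeaf b) ∪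
      (arcs (.block b) (.guard b) ∪ (arcs (.link b) (.guard b) ∪
        ⋃ b', ⋃ _ : b ≠ b', arcs (.block b) (.block b'))))))) := by
  refine .forBlock rfl rfl fun b => .seq (.edge ?_ ?_ rfl rfl) (.seq (.edge ?_ ?_ rfl rfl)
    (.seq (.edge ?_ ?_ rfl rfl) (.seq (.edge ?_ ?_ rfl rfl) (.seq (.edge ?_ ?_ rfl rfl)
      (.forBlock rfl rfl fun b' => .when (fun E σ h => ?_) diff_ne_zero_iff
        fun _ => .edge ?_ ?_ rfl rfl)))))
  case refine_11 => simp [h.reg, mul_comm]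
  all_goals exact fun _ σ h => by simp [h.reg, mul_comm]

theorem toNat_testBit (a i : ℕ) : (a.testBit i).toNat = a / 2 ^ i % 2 := by
  rw [Nat.testBit_eq_decide_div_mod_eq]
  rcases Nat.mod_two_eq_zero_or_one (a / 2 ^ i) with h | h <;> simp [h]

theorem Adds.bitEdges (b : Fin 3 × Fin s) (f : Fin (2 ^ s)) :
    let ρ := env s m ++ [(b.2 : ℕ), finProdFinEquiv b * 2 ^ s, f]
    Adds w (numbering s m) (.bitEdges b.1) ρ ρ
      (⋃ i, arcs (.assignment b f) (.value ((b.1, i), (f : ℕ).testBit i))) := by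
  intro ρ
  have hs : s ≤ graphOrder s m := by rw [graphOrder]; omega
  have hf : (f : ℕ) ≤ graphOrder s m := f.2.le.trans two_pow_le_graphOrder
  refine .count (ρ := fun _ => ρ) (fun _ => rfl) hs (fun _ _ => evals_var rfl) fun i => ?_
  let p : ℕ := 2 ^ (i : ℕ)
  let q : ℕ := f / p
  refine .scope (ρ'' := ρ ++ [(i : ℕ)] ++ [p] ++ [q] ++ [(f : ℕ) % p] ++ [q / 2] ++ [q % 2]) ?_
    (by simp)
  refine .compute (fun E => .twoPow (a := i) (evals_var rfl) (i.2.le.trans hs) rfl) ?_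
  refine .compute (fun E => .divMod (a := f) (b := p) (evals_var rfl) (evals_var rfl)
    (Nat.two_pow_pos _) ((Nat.div_le_self _ _).trans hf) rfl) ?_
  refine .compute (fun E => .divMod (a := q) (evals_var rfl) (evals_ofNat _ 2) two_pos
    ((Nat.div_le_self _ _).trans ((Nat.div_le_self _ _).trans hf)) rfl) ?_
  refine .edge ?_ ?_ rfl rfl <;>
    exact fun _ σ h => by simp [p, q, h.reg, mul_comm, add_assoc, toNat_testBit]

theorem Adds.assignmentEdges : Adds w (numbering s m) .assignmentEdges (env s m) (env s m)
    (⋃ b, ⋃ f, (arcs .z (.assignment b f) ∪ (arcs (.link b) (.assignment b f) ∪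
      ((⋃ b', ⋃ _ : b ≠ b', arcs (.assignment b f) (.detour b')) ∪
        ⋃ i, arcs (.assignment b f) (.value ((b.1, i), (f : ℕ).testBit i)))))) := by
  have hM := two_pow_le_graphOrder (s := s) (m := m)
  refine .forBlock rfl rfl fun b => ?_
  let ρ := env s m ++ [(b.2 : ℕ)] ++ [(finProdFinEquiv b : ℕ) * 2 ^ s]
  refine .scope (ρ'' := ρ) ?_ (by simp [ρ])
  refine .compute (fun E => .mul (a := finProdFinEquiv b) (fun σ h => ?_) (evals_var rfl) hM rfl) ?_
  · simp [h.reg, mul_comm]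
  refine .count (ρ := fun _ => ρ) (fun _ => rfl) hM (fun _ _ => evals_var rfl) fun f =>
    .seq (.edge ?_ ?_ rfl rfl) (.seq (.edge ?_ ?_ rfl rfl) (.seq
      (.forBlock rfl rfl fun b' => .when (fun E σ h => ?_) diff_ne_zero_iff
        fun _ => .edge ?_ ?_ rfl rfl) (.bitEdges b f)))
  case refine_5 => simp [ρ, h.reg, mul_comm]
  all_goals exact fun _ σ h => by simp [ρ, h.reg, mul_comm]

end Edges

end RAM

/-! ### Reading the clauses -/

theorem getD_flatMap {α β : Type*} {f : α → List β} {L : List α} {i r : ℕ} (hi : i < L.length)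
    (hr : r < (f L[i]).length) (b : β) :
    (L.flatMap f).getD (((L.take i).flatMap f).length + r) b = (f L[i]).getD r b := by
  conv_lhs => enter [1, 2]; rw [← List.take_append_drop i L, List.drop_eq_getElem_cons hi]
  rw [List.flatMap_append, List.flatMap_cons, List.getD_append_right _ _ _ _ (Nat.le_add_right ..),
    Nat.add_sub_cancel_left, List.getD_append _ _ _ _ hr]

namespace Partitioned3SAT

/-- The part of the input word that describes the literal `l`. -/
def literalWord {n : ℕ} (l : PartLiteral n) : List ℕ := [l.part, l.idx, if l.sign then 1 else 0]

/-- The part of the input word that describes the clause `C`. -/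
def clauseWord {n : ℕ} (C : List (PartLiteral n)) : List ℕ := C.length :: C.flatMap literalWord

/-- The position of the clause with number `c` in the input word. -/
def clauseStart (ψ : Partitioned3SAT) (c : ℕ) : ℕ :=
  2 + ((ψ.clauses.take c).flatMap clauseWord).length

theorem length_flatMap_literalWord {n : ℕ} (C : List (PartLiteral n)) :
    (C.flatMap literalWord).length = 3 * C.length := by
  simp [literalWord, mul_comm]

section Encode

variable {ψ : Partitioned3SAT} {c : ℕ} (hc : c < ψ.clauses.length)

include hc

theorem clauseStart_succ :
    ψ.clauseStart (c + 1) = ψ.clauseStart c + 1 + 3 * ψ.clauses[c].length := by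
  simp only [clauseStart, List.take_add_one, List.getElem?_eq_getElem hc, Option.toList_some,
    List.flatMap_append, List.length_append, List.flatMap_singleton, clauseWord, List.length_cons,
    length_flatMap_literalWord]
  ring

theorem getD_encode_clauseStart_add {r : ℕ} (hr : r < (clauseWord ψ.clauses[c]).length) :
    ψ.encode.getD (ψ.clauseStart c + r) 0 = (clauseWord ψ.clauses[c]).getD r 0 := by
  rw [clauseStart, add_assoc, add_comm]
  exact getD_flatMap hc hr 0

theorem getD_encode_length : ψ.encode.getD (ψ.clauseStart c) 0 = ψ.clauses[c].length :=
  getD_encode_clauseStart_add hc (Nat.succ_pos _)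

theorem getD_encode_literal {i r : ℕ} (hi : i < ψ.clauses[c].length) (hr : r < 3) :
    ψ.encode.getD (ψ.clauseStart c + 1 + 3 * i + r) 0 =
      (literalWord ψ.clauses[c][i]).getD r 0 := by
  have hpos : ((ψ.clauses[c].take i).flatMap literalWord).length = 3 * i := by
    rw [length_flatMap_literalWord, List.length_take_of_le hi.le]
  have hlen : 3 * i + r < (ψ.clauses[c].flatMap literalWord).length := by
    rw [length_flatMap_literalWord]
    omega
  rw [show ψ.clauseStart c + 1 + 3 * i + r = ψ.clauseStart c + (3 * i + r + 1) by ring,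
    getD_encode_clauseStart_add hc (Nat.succ_lt_succ hlen), clauseWord, List.getD_cons_succ, ← hpos]
  exact getD_flatMap hi hr 0

end Encode

end Partitioned3SAT

namespace RAM

open Partitioned3SAT

/-- The edges at the clause with the number in register `5` for a literal with its part, index and
sign in the registers `8`, `9` and `10`. -/
def Com.literalEdges : Com :=
  .divMod 11 (.var 9) (.var 0) ;;
  .forPart fun δ => .when (1 - .diff (.var 8) (.lit δ)) (
    .edge 13 (.clause (.var 5)) (.block (.block δ (.var 11))) ;;
    .edge 13 (.clause (.var 5)) (.value (2 • .block δ (.var 12) + .var 10)))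

/-- Reads a literal at the position in register `4`, and adds the edges for it. -/
def Com.readLiteral : Com :=
  8 ::= .get 0 (.var 4) ;; 9 ::= .get 0 (.var 4 + 1) ;; 10 ::= .get 0 (.var 4 + 2) ;;
  4 ::= .var 4 + 3 ;; .literalEdges

/-- The edges at the clauses. -/
def Com.clauseEdges : Com :=
  4 ::= 2 ;; .count 5 (.var 2) (
    6 ::= .get 0 (.var 4) ;; 4 ::= .var 4 + 1 ;; .count 7 (.var 6) .readLiteral)

/-- The edges at the clause with number `c` for the literal `l`. -/
def literalArcs {n s m : ℕ} (h : n ≤ s * s) (c : Fin m) (l : PartLiteral n) :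
    Set (Vertex s m × Vertex s m) :=
  arcs (.clause c) (.block (l.part, (l.idx.castLE h).divNat)) ∪
    arcs (.clause c) (.value ((l.part, (l.idx.castLE h).modNat), l.sign))

section Clauses

theorem graphOrder_sub (s m : ℕ) : graphOrder s m - m = 25 * s + 2 + 3 * s * 2 ^ s :=
  Nat.add_sub_cancel ..

variable {n s m : ℕ} [NeZero s] {w : List ℕ}

theorem Adds.literalEdges {ρ : List ℕ} (h : n ≤ s * s) (c : Fin m) (l : PartLiteral n) (p k i : ℕ)
    (hρ : ρ = env s m ++ [p, c, k, i] ++ literalWord l) :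
    Adds w (numbering s m) .literalEdges ρ ρ (literalArcs h c l) := by
  subst hρ
  have hs : s ≤ graphOrder s m := by rw [graphOrder]; omega
  have hq : (l.idx : ℕ) / s ≤ graphOrder s m :=
    (Nat.div_le_of_le_mul (l.idx.2.le.trans h)).trans hs
  let ρ := env s m ++ [p, c, k, i] ++ literalWord l ++ [(l.idx : ℕ) / s] ++ [(l.idx : ℕ) % s]
  have hF : literalArcs h c l = ⋃ δ, ⋃ _ : δ = l.part, literalArcs h c l := by simp
  rw [hF]
  refine .scope (ρ'' := ρ) ?_ (by simp [ρ])
  refine .compute (fun E => .divMod (a := l.idx) (evals_var rfl) (evals_var rfl) (NeZero.pos s) hq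
    rfl) ?_
  refine .forPart fun δ => .when (a := 1 - ((l.part - δ : ℕ) + (δ - l.part))) (fun E σ h => ?_)
    (by rw [Fin.ext_iff]; omega) ?_
  · simp [h.reg, literalWord]
  rintro rfl
  refine .seq (.edge ?_ ?_ rfl rfl) (.edge ?_ ?_ rfl rfl) <;>
    exact fun _ σ h => by simp [h.reg, graphOrder_sub, literalWord, Bool.toNat, add_assoc, mul_comm]

theorem Adds.readLiteral {ψ : Partitioned3SAT} (h : ψ.n ≤ s * s) (c : Fin ψ.clauses.length)
    (i : Fin ψ.clauses[c].length) :
    let ρ (i : ℕ) := env s ψ.clauses.length ++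
      [ψ.clauseStart c + 1 + 3 * i, (c : ℕ), ψ.clauses[c].length]
    Adds ψ.encode (numbering s ψ.clauses.length) .readLiteral (ρ i ++ [(i : ℕ)])
      (ρ (i + 1) ++ [(i : ℕ)]) (literalArcs h c ψ.clauses[c][i]) := by
  intro ρ
  let l := ψ.clauses[c][i]
  have read {r : ℕ} (hr : r < 3) {ρ : List ℕ} {e : Exp} {E}
      (he : Evals ⟨ρ, memory ψ.encode (numbering s ψ.clauses.length) E, []⟩ e
        (ψ.clauseStart c + 1 + 3 * i + r)) :
      Evals ⟨ρ, memory ψ.encode (numbering s ψ.clauses.length) E, []⟩ (.get 0 e)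
        ((literalWord l).getD r 0) := fun σ h =>
    (evals_get he σ h).trans (getD_encode_literal c.2 i.2 hr)
  refine .scope (ρ'' := ρ (i + 1) ++ [(i : ℕ)] ++ literalWord l) ?_ (List.prefix_append ..)
  refine .compute (fun E => .assign_push (read three_pos (evals_var rfl)) rfl) ?_
  refine .compute (fun E => .assign_push (read (r := 1) (by norm_num)
    (.add (evals_var rfl) (evals_ofNat _ 1))) rfl) ?_
  refine .compute (fun E => .assign_push (read (r := 2) (by norm_num)
    (.add (evals_var rfl) (evals_ofNat _ 2))) rfl) ?_
  refine .compute (fun E => .assign (.add (evals_var rfl) (evals_ofNat _ 3))) ?_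
  exact .literalEdges h c l _ _ _ rfl

theorem Adds.clauseEdges {ψ : Partitioned3SAT} (h : ψ.n ≤ s * s) :
    let ρ := env s ψ.clauses.length
    Adds ψ.encode (numbering s ψ.clauses.length) .clauseEdges ρ ρ
      (⋃ c : Fin ψ.clauses.length, ⋃ i : Fin ψ.clauses[c].length,
        literalArcs h c ψ.clauses[c][i]) := by
  intro ρ
  let m := ψ.clauses.length
  have hm : m ≤ graphOrder s m := Nat.le_add_left ..
  let start (c : ℕ) : List ℕ := ρ ++ [ψ.clauseStart c]
  refine .scope (ρ'' := start m) ?_ (List.prefix_append ..)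
  refine .compute (ρ' := start 0) (fun E => .assign_push (evals_ofNat _ 2) rfl) ?_
  refine .count (fun _ => rfl) hm (fun _ _ => evals_var rfl) fun c => ?_
  let k : ℕ := ψ.clauses[c].length
  have hk : k ≤ graphOrder s m := by
    have : k ≤ 3 := ψ.length_le _ (ψ.clauses.getElem_mem c.2)
    have := NeZero.pos s
    rw [graphOrder]
    omega
  let pos (i : ℕ) : List ℕ := ρ ++ [ψ.clauseStart c + 1 + 3 * i, (c : ℕ), k]
  refine .scope (ρ'' := pos k) ?_ ⟨[k], by simp [start, pos, clauseStart_succ c.2, k]⟩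
  refine .compute (ρ' := start c ++ [(c : ℕ)] ++ [k])
    (fun E => .assign_push (fun σ h => ?_) rfl) ?_
  · exact (evals_get (evals_var rfl) σ h).trans (getD_encode_length c.2)
  refine .compute (ρ' := pos 0) (fun E => .assign (a := ψ.clauseStart c + 1)
    (.add (evals_var rfl) (evals_ofNat _ 1))) ?_
  exact .count (fun _ => rfl) hk (fun _ _ => evals_var rfl) (.readLiteral h c)

end Clauses

/-! ### The program of the reduction -/

theorem adj_iff_exists_mem_arcs {β α τ Γ π : Type*} {D : ChoicePattern β α τ Γ}
    {p : GadgetVertex β α τ Γ π × GadgetVertex β α τ Γ π} :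
    (D.graph π).Adj p.1 p.2 ↔ ∃ u v, D.Edge u v ∧ p ∈ arcs u v := by
  constructor
  · rintro (h | h)
    exacts [⟨_, _, h, .inl rfl⟩, ⟨_, _, h, .inr rfl⟩]
  · rintro ⟨u, v, h, rfl | rfl⟩
    exacts [h.adj, h.adj_symm]

section Reduction

variable {ψ : Partitioned3SAT} {s : ℕ} [NeZero s]

/-- The edges of the graph of the reduction. -/
def Com.graphEdges : Com :=
  .leafEdges ;; .valueEdges ;; .blockEdges ;; .assignmentEdges ;; .clauseEdges

theorem Adds.graphEdges (h : ψ.n ≤ s * s) :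
    let ρ := env s ψ.clauses.length
    Adds ψ.encode (numbering s ψ.clauses.length) .graphEdges ρ ρ
      {p | ((ψ.blockPattern s).graph (Fin (4 * s - 1))).Adj p.1 p.2} := by
  intro ρ
  refine Eq.mp (congrArg (Adds _ _ _ ρ ρ) (Set.ext fun p => ?_))
    (leafEdges.seq (valueEdges.seq (blockEdges.seq (assignmentEdges.seq (clauseEdges h)))))
  simp only [Set.mem_ofPred_eq, adj_iff_exists_mem_arcs, Set.mem_union, Set.mem_iUnion, literalArcs]
  constructor
  · rintro ((hp | ⟨i, hp⟩) | ⟨b, hp | hp⟩ | ⟨b, hp | hp | hp | hp | hp | ⟨b', hb, hp⟩⟩ |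
      ⟨b, f, hp | hp | ⟨b', hb, hp⟩ | ⟨i, hp⟩⟩ | ⟨c, i, hp | hp⟩) <;>
    refine ⟨_, _, ?_, hp⟩
    exacts [.yLeaf, .zLeaf i, .yValue _, .yValue _, .yBlock b, .blockDetour b, .blockLeaf b,
      .blockGuard b, .linkGuard b, .blockBlock b b' hb, .zAssignment b f, .linkAssignment b f,
      .assignmentDetour b b' f hb, .assignmentValue b f _ (sat_blockPattern_iff.2 ⟨i, rfl⟩),
      .clauseBlock c _ ((inBlock_blockPattern_iff h).2 ⟨i, rfl⟩),
      .clauseValue c _ ((inValue_blockPattern_iff h).2 ⟨i, rfl⟩)]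
  · rintro ⟨u, v, he, hp⟩
    cases he with
    | yLeaf => exact .inl (.inl hp)
    | zLeaf i => exact .inl (.inr ⟨i, hp⟩)
    | yValue j =>
      rcases j with ⟨b, _ | _⟩
      exacts [.inr (.inl ⟨b, .inl hp⟩), .inr (.inl ⟨b, .inr hp⟩)]
    | yBlock b => exact .inr (.inr (.inl ⟨b, .inl hp⟩))
    | blockDetour b => exact .inr (.inr (.inl ⟨b, .inr (.inl hp)⟩))
    | blockLeaf b => exact .inr (.inr (.inl ⟨b, .inr (.inr (.inl hp))⟩))
    | blockGuard b => exact .inr (.inr (.inl ⟨b, .inr (.inr (.inr (.inl hp)))⟩))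
    | linkGuard b => exact .inr (.inr (.inl ⟨b, .inr (.inr (.inr (.inr (.inl hp))))⟩))
    | blockBlock b b' hb =>
      exact .inr (.inr (.inl ⟨b, .inr (.inr (.inr (.inr (.inr ⟨b', hb, hp⟩))))⟩))
    | zAssignment b f => exact .inr (.inr (.inr (.inl ⟨b, f, .inl hp⟩)))
    | linkAssignment b f => exact .inr (.inr (.inr (.inl ⟨b, f, .inr (.inl hp)⟩)))
    | assignmentDetour b b' f hb =>
      exact .inr (.inr (.inr (.inl ⟨b, f, .inr (.inr (.inl ⟨b', hb, hp⟩))⟩)))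
    | assignmentValue b f j hj =>
      obtain ⟨i, rfl⟩ := sat_blockPattern_iff.1 hj
      exact .inr (.inr (.inr (.inl ⟨b, f, .inr (.inr (.inr ⟨i, hp⟩))⟩)))
    | clauseBlock c b hb =>
      obtain ⟨i, rfl⟩ := (inBlock_blockPattern_iff h).1 hb
      exact .inr (.inr (.inr (.inr ⟨c, i, .inl hp⟩)))
    | clauseValue c j hj =>
      obtain ⟨i, rfl⟩ := (inValue_blockPattern_iff h).1 hj
      exact .inr (.inr (.inr (.inr ⟨c, i, .inr hp⟩)))

end Reduction

/-- The computation of the number of blocks, by running through the square numbers. -/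
def Com.blockSize : Com :=
  0 ::= 1 ;; 1 ::= 1 ;;
    .loop (.get 0 0 - .var 1) (1 ::= .var 1 + 2 • .var 0 + 1 ;; 0 ::= .var 0 + 1)

theorem Runs.blockSize {M : ℕ} {mem : ℕ → ℕ → ℕ} (h : Nat.sqrt (mem 0 0 - 1) ≤ M) :
    Runs M .blockSize ⟨[], mem, []⟩ ⟨[Partitioned3SAT.blockSize (mem 0 0)], mem, []⟩ := by
  let s := Partitioned3SAT.blockSize (mem 0 0)
  let v (i : ℕ) : View := ⟨[i + 1, (i + 1) * (i + 1)], mem, []⟩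
  have htest (i : ℕ) : Evals (v i) (.get 0 0 - .var 1) (mem 0 0 - (i + 1) * (i + 1)) :=
    (evals_get (evals_ofNat _ 0)).sub (evals_var rfl)
  refine .seq (.assign_push (evals_ofNat _ 1) rfl)
    (.seq (v' := v 0) (.assign_push (evals_ofNat _ 1) rfl) (.pop (a := s * s) ?_))
  refine .loop (v := v) h (fun i hi => ⟨_, ?_, htest i⟩) ?_ fun i _ => ?_
  · have : (i + 1) * (i + 1) ≤ mem 0 0 - 1 := Nat.le_sqrt.1 hi
    have : 0 < (i + 1) * (i + 1) := by positivity
    omega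
  · exact fun σ hσ => (htest _ σ hσ).trans
      (Nat.sub_eq_zero_of_le (le_blockSize_mul_self (mem 0 0)))
  · have hsquare : Evals (v i) (.var 1 + 2 • .var 0 + 1) ((i + 1 + 1) * (i + 1 + 1)) := by
      rw [show (i + 1 + 1) * (i + 1 + 1) = (i + 1) * (i + 1) + 2 * (i + 1) + 1 by ring]
      exact ((evals_var rfl).add ((evals_var rfl).smul 2)).add (evals_ofNat _ 1)
    exact .seq (.assign hsquare) (.assign ((evals_var rfl).add (evals_ofNat _ 1)))

/-- The initialization of the four registers described by `env`. -/
def Com.dimensions : Com :=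
  .blockSize ;; .twoPow 1 (.var 0) ;; 2 ::= .get 0 1 ;; .mul 3 (3 • .var 0) (.var 1) ;;
    3 ::= 25 • .var 0 + 2 + .var 3 + .var 2

theorem Runs.dimensions (ψ : Partitioned3SAT) :
    let s := Partitioned3SAT.blockSize ψ.n
    let m := ψ.clauses.length
    Runs (graphOrder s m) .dimensions ⟨[], (initial ψ.encode).mem, []⟩
      ⟨env s m, (initial ψ.encode).mem, []⟩ := by
  intro s m
  have hs : s ≤ graphOrder s m := by rw [graphOrder]; omega
  refine .seq (.blockSize ((Nat.le_succ _).trans hs)) ?_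
  refine .seq (.twoPow (evals_var rfl) hs rfl) ?_
  refine .seq (.assign_push (evals_get (evals_ofNat _ 1)) rfl) ?_
  refine .seq (.mul ((evals_var rfl).smul 3) (evals_var rfl) two_pow_le_graphOrder rfl) ?_
  exact .assign (((((evals_var rfl).smul 25).add (evals_ofNat _ 2)).add (evals_var rfl)).add
    (evals_var rfl))

/-- The output of the instance of Geodetic Set; the adjacency matrix is in memory bank `1`. -/
def Com.output : Com :=
  .print (10 • .var 0) ;; .print (.var 3) ;;
    .count 4 (.var 3) (.mul 5 (.var 4) (.var 3) ;;
      .count 6 (.var 3) (.print (.get 1 (.var 5 + .var 6))))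

theorem Runs.printRow {ρ out : List ℕ} {mem : ℕ → ℕ → ℕ} {a b x y z N : ℕ} (ha : ρ[x]? = some a)
    (hN : ρ[z]? = some N) (hy : y = ρ.length) :
    Runs N (.count y (.var z) (.print (.get b (.var x + .var y)))) ⟨ρ, mem, out⟩
      ⟨ρ, mem, out ++ (List.range N).map fun j => mem b (a + j)⟩ := by
  let v (j : ℕ) : View := ⟨ρ, mem, out ++ (List.range j).map fun j => mem b (a + j)⟩
  have hv : v 0 = ⟨ρ, mem, out⟩ := by simp [v]
  rw [← hv]
  refine .count (v := v) (fun _ => hy) le_rfl (fun _ => evals_var hN) fun j _ => ?_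
  have hout : { (v j).push j with out := (v j).out ++ [mem b (a + j)] } = (v (j + 1)).push j := by
    simp [v, View.push, List.range_succ]
  have hx : Evals (v j) (.var x) a := evals_var ha
  exact hout ▸ .print (evals_get (hx.push.add (evals_var_push hy)))

theorem Runs.output {s m : ℕ} {mem : ℕ → ℕ → ℕ} :
    let N := graphOrder s m
    Runs N .output ⟨env s m, mem, []⟩ ⟨env s m, mem, 10 * s :: N ::
      (List.range N).flatMap fun i => (List.range N).map fun j => mem 1 (i * N + j)⟩ := by
  intro N
  let v (i : ℕ) : View := ⟨env s m, mem, 10 * s :: N ::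
    (List.range i).flatMap fun i => (List.range N).map fun j => mem 1 (i * N + j)⟩
  refine .seq (.print ((evals_var rfl).smul 10)) (.seq (.print (evals_var rfl)) ?_)
  refine .count (v := v) (fun _ => rfl) le_rfl (fun _ => evals_var rfl) fun i _ => ?_
  refine .pop (a := i * N) ?_
  refine .seq (.mul (evals_var rfl) (evals_var rfl) le_rfl rfl) ?_
  have hrow := Runs.printRow (ρ := env s m ++ [i] ++ [i * N]) (mem := mem) (out := (v i).out)
    (a := i * N) (b := 1) (x := 5) (z := 3) (N := N) rfl rfl rfl
  simpa [v, View.push, List.range_succ] using hrow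

/-- The program of the reduction. -/
def Com.reduction : Com := .dimensions ;; .graphEdges ;; .output

open Classical in
theorem encode_eq {V : Type*} {G : SimpleGraph V} {I : GeodeticSetInstance} {num : V ≃ Fin I.order}
    (h : ∀ i j, I.graph.Adj i j ↔ G.Adj (num.symm i) (num.symm j)) (w : List ℕ) :
    I.encode = I.k :: I.order :: (List.range I.order).flatMap fun i => (List.range I.order).map
      fun j => memory w num {p | G.Adj p.1 p.2} 1 (i * I.order + j) := by
  have hmem (i j : Fin I.order) : memory w num {p | G.Adj p.1 p.2} 1 (i * I.order + j) =
      if I.graph.Adj i j then 1 else 0 := by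
    simpa only [num.apply_symm_apply, Set.mem_ofPred_eq, ← h] using
      memory_one_apply w num {p | G.Adj p.1 p.2} (num.symm i) (num.symm j)
  simp only [← List.map_coe_finRange_eq_range, List.flatMap_map, List.map_map, Function.comp_def,
    hmem]
  rfl

theorem runsTo_reduction (ψ : Partitioned3SAT) :
    ∃ t ≤ Com.reduction.time.eval ψ.geodeticInstance.order,
      RunsTo .reduction ψ.encode t ψ.geodeticInstance.encode := by
  have hdim := Runs.dimensions ψ
  rw [initial_mem ψ.encode (numbering (Partitioned3SAT.blockSize ψ.n) _)] at hdim
  have hrun := hdim.seq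
    ((Adds.graphEdges (Partitioned3SAT.le_blockSize_mul_self ψ.n) ∅).seq Runs.output)
  obtain ⟨t, τ, hP, ht, hτ⟩ := hrun (initial ψ.encode)
    ⟨fun x hx => absurd hx (Nat.not_lt_zero x), initial_mem _ _, rfl⟩
  refine ⟨t, ht, τ, hP, hτ.out.trans ?_⟩
  rw [Set.empty_union]
  exact (encode_eq (I := ψ.geodeticInstance) (fun _ _ => Iff.rfl) _).symm

end RAM

theorem theorem4 :
    ∃ (P : RAM.Com) (c : ℝ), ∀ ψ : Partitioned3SAT,
      ∃ (I : GeodeticSetInstance) (t : ℕ),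
        RAM.RunsTo P ψ.encode t I.encode ∧
        (ψ.Satisfiable ↔ I.IsYes) ∧
        (0 < ψ.n →
          (t : ℝ) ≤ 2 ^ (c * √(ψ.numVars : ℝ)) ∧
          I.k = 10 * ⌈√(ψ.n : ℝ)⌉₊ ∧
          (I.vc : ℝ) + (I.k : ℝ) ≤ c * √(ψ.numVars : ℝ) ∧
          (I.order : ℝ) ≤ 2 ^ (c * √(ψ.numVars : ℝ))) := by
  obtain ⟨e, he⟩ := Partitioned3SAT.exists_eval_order_le RAM.Com.reduction.time
  refine ⟨.reduction, 2 * e + 54, fun ψ => ?_⟩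
  obtain ⟨t, ht, hrun⟩ := RAM.runsTo_reduction ψ
  refine ⟨ψ.geodeticInstance, t, hrun, ψ.isYes_geodeticInstance_iff.symm, fun hn =>
    ⟨Partitioned3SAT.natCast_le_two_rpow hn (ht.trans (he ψ)) (by linarith),
      congrArg (10 * ·) (Partitioned3SAT.blockSize_eq hn), ?_,
      Partitioned3SAT.natCast_le_two_rpow hn ψ.order_geodeticInstance_le ?_⟩⟩
  · calc (ψ.geodeticInstance.vc : ℝ) + ψ.geodeticInstance.k
        ≤ 27 * (Partitioned3SAT.blockSize ψ.n : ℝ) := by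
          exact_mod_cast ψ.vc_add_k_geodeticInstance_le
      _ ≤ 27 * (2 * √ψ.numVars) := by
        gcongr
        exact Partitioned3SAT.blockSize_le_two_mul_sqrt_numVars hn
      _ = 54 * √ψ.numVars := by ring
      _ ≤ (2 * e + 54) * √ψ.numVars := by gcongr; linarith
  · push_cast
    linarith [e.cast_nonneg (α := ℝ)]
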